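/- **Maps.** A \emph{bipartite planar map} is a connected bipartite graph (multiple edges allowed), with vertices coloured black and white so that every edge joins a black vertex to a white one, drawn in the plane without crossings and considered up to orientation-preserving continuous deformation. It is \emph{rooted} at a corner of the outer face at a black vertex (the root vertex). Let $\mathcal M_n$ be the set of rooted bipartite planar maps with $n$ edges; $\mathcal M_0$ consists of the map with one black vertex. Let $\mathbf{black}(M)$, $\mathbf{white}(M)$, $\mathbf{face}(M)$ be the numbers of black vertices, white vertices and faces (including the outer face) of $M$, and let $\mathbf{outdeg}(M)$ be half the degree of the outer face ($0$ for the one-vertex map). **Trees.** A \emph{degree tree} is a pair $(T,\ell)$ of a plane tree $T$ and an integer labelling $\ell$ of its nodes such that $\ell(v)=0$ for each leaf $v$, and $\ell(v)=k-a+\ell(v_1)+\dots+\ell(v_k)$ for some integer $a$ with $0\le a\le \ell(v_1)$ for each internal node $v$ with children $v_1,\dots,v_k$ from left to right. The integer $a$ is called the label of the leftmost descending edge of $v$; all other edges are labelled $0$, and the edge labels are denoted by $\ell_\Lambda$. An internal node is a \emph{zero node} if $a=0$ and a \emph{positive node} otherwise. Let $\mathcal T_n$ be the set of degree trees with $n$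 edges, $\mathbf{lnode}$, $\mathbf{znode}$, $\mathbf{pnode}$ the numbers of leaves, zero nodes and positive nodes, and $\mathbf{rlabel}$ the label $\ell$ of the root. **The transformation $\mathbf T_{\mathcal M}$.** Start at the root vertex of $M$, with the edge clockwise next to the root corner as pending edge (if $n=0$, the tree has one node). Let $u$ be the current vertex and $e$ the pending edge; $e$ is deleted from the remaining map, and a tree edge $e_T$ is added. (A1) If $e$ is a bridge of the remaining map to a vertex of degree $1$, then $e_T=e$, labelled $0$, and the current vertex stays $u$. (A2) If $e$ is a bridge to a vertex $v$ of degree at least $2$, let $e_1$ be the edge clockwise next to $e$ around $v$ and $w$ the other end of $e_1$; then $e_T$ joins $u$ to $w$ so that $e,e_1,e_T$ bound a face with $u,v,w$ in counterclockwise order, it is labelled $0$, and $w$ becomes current. (A3) If $e$ is not a bridge, it separates the outer face from a face of some degree $2m$; split $u$ into $u_T$, which keeps the tree edges, and its new child $u_M$, which takes the remaining map edges, let $e_T$ join them, labelled $m$, and make $u_M$ current. The next pending edge is the next remaining map edge clockwise from $e_T$ around the current vertex; if there is none, backtrack in the tree to the first vertex that has one, and stop if no such vertex exists. The children of a node are thus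 found from right to left. The result is the plane tree with the node labels $\ell$ computed from the edge labels by $\ell(v)=k-a+\ell(v_1)+\dots+\ell(v_k)$. **The transformation $\mathbf M_{\mathcal T}$.** Deal with the non-root nodes $u$ of a degree tree in postorder (children from left to right, then the node). Let $e_u$ be the edge from $u$ to its parent $u^*$, and $M_u$ the map into which the subtree of $u$ has been turned, attached at $u$. (A1') If $u$ is a leaf, $e_u$ becomes a map edge to a white vertex $u$. (A2') If $u$ is not a leaf and $e_u$ is labelled $0$, let $e'$ be the edge next to $e_u$ around $u$ in counterclockwise order and $v$ its other end; add a map edge $e_M$ from $u^*$ to $v$ such that the triangle $e_u,e',e_M$ is empty and has $u^*,u,v$ in clockwise order, and delete $e_u$. (A3') If $e_u$ has a label $m>0$, start at the corner of $M_u$ just clockwise after $e_u$, walk clockwise along $2m-1$ edges of the outer face of $M_u$, join the two corners by a new map edge which cuts off a face of degree $2m$, and contract $e_u$. The root corner is that of the tree. **Proposition.** For every $n\ge 0$, $\mathbf T_{\mathcal M}$ is a bijection from $\mathcal M_n$ to $\mathcal T_n$, and its inverse is $\mathbf M_{\mathcal T}$, which maps $\mathcal T_n$ to $\mathcal M_n$.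 Moreover, for $M\in\mathcal M_n$ and $(T,\ell)=\mathbf T_{\mathcal M}(M)$, $$\mathbf{face}(M)=1+\mathbf{pnode}(T,\ell),\qquad \mathbf{outdeg}(M)=\mathbf{rlabel}(T,\ell),$$ and, if $n\ge 1$, $$\mathbf{white}(M)=\mathbf{lnode}(T,\ell),\qquad \mathbf{black}(M)=\mathbf{znode}(T,\ell).$$ -/

import Mathlib

namespace BipTree

open Equiv

/-! ## Surgery on cyclic orders

A permutation of a finite set is read as a family of cyclic orders (its cycles). -/

section Surgery

variable {α : Type*}

open Classical in
/-- Take `x` out of its cycle: `x` becomes a fixed point, its predecessor is now followed by its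
former successor. -/
noncomputable def detach (π : Perm α) (x : α) : Perm α := swap x (π x) * π

open Classical in
/-- Insert the fixed point `x` of `π` immediately after `y` in the cycle of `y`. -/
noncomputable def insertAfter (π : Perm α) (x y : α) : Perm α := π * swap x y

open Classical in
/-- Insert the fixed point `x` of `π` immediately before `y` in the cycle of `y`. -/
noncomputable def insertBefore (π : Perm α) (x y : α) : Perm α := swap x y * π

/-- The number of cycles of a permutation, fixed points included. -/
noncomputable def numCycles (π : Perm α) : ℕ := Nat.card (Quotient (Perm.SameCycle.setoid π))

end Surgery

/-! ## Rooted bipartite maps as rotation systems -/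

/-- The rotation system of a bipartite graph drawn on an oriented surface, with edge set `E` and a
marked corner at a black vertex. The marked corner is represented by a *root leg* `none`, a
half-edge drawn into that corner. The cycles of `black` are the black vertices, each given by the
clockwise cyclic order of the edges (and possibly the root leg) around it; the cycles of `white`
are the white vertices, likewise in clockwise order. For `E` empty there is exactly one black
vertex, which carries the root leg, and no white vertex. -/
structure RotationSystem (E : Type) where
  black : Perm (Option E)
  white : Perm E

namespace RotationSystem

variable {E : Type} (M : RotationSystem E)

/-- Walk along a face: an edge `e` (walked from its black end `u` to its white end `v`) is followed
by the edge clockwise next to `e` around `v`, walked to its black end `w`, and then by what is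
clockwise next around `w`. The cycles of this permutation are the faces. In a cycle, the element
`some e` stands for the corner at the black end of `e` just before `e` in clockwise order, while
`none` only marks the face that contains the root corner, which is the outer face. -/
def faces : Perm (Option E) := M.black * optionCongr M.white

/-- Half the degree of the face through `c`. The corners of a face alternate between black
and white vertices, so half of their number is the number of corners at black vertices. -/
noncomputable def halfDegree (c : Option E) : ℕ := {x : E | M.faces.SameCycle c (some x)}.ncard

/-- Elementary links between half-edges (`Sum.inl` at black vertices, `Sum.inr` at white vertices):
consecutive half-edges around a vertex, and the two halves of an edge, where only the edges in `S`
may be used. -/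
inductive Step (S : Set E) : Option E ⊕ E → Option E ⊕ E → Prop
  | black (x : Option E) : Step S (Sum.inl x) (Sum.inl (M.black x))
  | white (e : E) : Step S (Sum.inr e) (Sum.inr (M.white e))
  | edge (e : E) (he : e ∈ S) : Step S (Sum.inl (some e)) (Sum.inr e)

/-- Two half-edges are at vertices that a path using only edges in `S` connects. -/
def Linked (S : Set E) : Option E ⊕ E → Option E ⊕ E → Prop := Relation.EqvGen (M.Step S)

/-- The underlying graph is connected. -/
def Connected : Prop := ∀ x y, M.Linked Set.univ x y

/-- The edge `e` is a bridge: its ends are not connected without `e`. -/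
def IsBridge (e : E) : Prop := ¬ M.Linked {f | f ≠ e} (Sum.inl (some e)) (Sum.inr e)

noncomputable def numBlack : ℕ := numCycles M.black

noncomputable def numWhite : ℕ := numCycles M.white

noncomputable def numFaces : ℕ := numCycles M.faces

/-- The half-degree of the outer face. -/
noncomputable def outdeg : ℕ := M.halfDegree none

/-- A planar map: connected, and of genus zero by Euler's formula. -/
def IsPlanarMap : Prop :=
  M.Connected ∧ M.numBlack + M.numWhite + M.numFaces = Nat.card E + 2

/-- Delete the edge `e`. The type of edges is kept: a deleted edge is detached from both of its
ends, so nothing that is linked to the root leg sees it any more. -/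
noncomputable def delete (e : E) : RotationSystem E where
  black := detach M.black (some e)
  white := detach M.white e

/-- Move the root leg to the corner that comes just after the edge `e` in clockwise order around
the black end of `e`. -/
noncomputable def moveRoot (e : E) : RotationSystem E where
  black := insertAfter (detach M.black none) none (some e)
  white := M.white

/-- `f` is an isomorphism of rooted maps that preserves colours and orientation. -/
def IsIso {E' : Type} (M' : RotationSystem E') (f : E ≃ E') : Prop :=
  (∀ x, M'.black (optionCongr f x) = optionCongr f (M.black x)) ∧
    ∀ e, M'.white (f e) = f (M.white e)

end RotationSystem

/-- A rooted bipartite graph drawn on an oriented surface, with a finite set of edges. -/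
structure BipartiteMap : Type 1 where
  Edge : Type
  [finite : Finite Edge]
  rot : RotationSystem Edge

attribute [instance] BipartiteMap.finite

/-! ## Plane trees and degree trees -/

/-- Plane trees with a decoration on each node; the list holds the children from left to right. -/
inductive PlaneTree (α : Type) : Type
  | node (label : α) (children : List (PlaneTree α)) : PlaneTree α

namespace PlaneTree

variable {α : Type}

/-- The decoration of the root. -/
def label : PlaneTree α → α
  | node a _ => a

/-- The subtrees at the children of the root, from left to right. -/
def children : PlaneTree α → List (PlaneTree α)
  | node _ cs => cs

/-- The number of edges. -/
def size : PlaneTree α → ℕ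
  | node _ cs => (cs.map fun c => 1 + size c).sum

/-- The list of the subtrees induced by all nodes. -/
def subtrees : PlaneTree α → List (PlaneTree α)
  | node a cs => node a cs :: (cs.map subtrees).flatten

/-- Add a new rightmost child (with its subtree) to the root. -/
def addRight : PlaneTree α → PlaneTree α → PlaneTree α
  | node a cs, c => node a (cs ++ [c])

/-- From edge labels to node labels. In the argument an internal node is decorated with the label
`a` of its leftmost descending edge, all other edges being labelled `0`; in the result, a node with
children `v₁, …, v_k` has the label `k - a + ℓ(v₁) + ⋯ + ℓ(v_k)` (which is `0` for a leaf, whose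
decoration is `0`). -/
def nodeLabels : PlaneTree ℕ → PlaneTree ℤ
  | node a cs => node (cs.length - a + ((cs.map nodeLabels).map label).sum) (cs.map nodeLabels)

/-- The value of `a` in `ℓ(v) = k - a + ℓ(v₁) + ⋯ + ℓ(v_k)` at the root `v`, which is the label of
the leftmost descending edge of `v` when `v` is an internal node. -/
def edgeLabel : PlaneTree ℤ → ℤ
  | node l cs => cs.length + (cs.map label).sum - l

/-- Degree trees `(T, ℓ)`, where `T` is decorated with the labels `ℓ`. -/
inductive IsDegreeTree : PlaneTree ℤ → Prop
  | leaf : IsDegreeTree (node 0 [])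
  | internal (v₁ : PlaneTree ℤ) (vs : List (PlaneTree ℤ)) (a : ℤ)
      (hv : ∀ v ∈ v₁ :: vs, IsDegreeTree v) (ha₀ : 0 ≤ a) (ha₁ : a ≤ v₁.label) :
      IsDegreeTree
        (node (((v₁ :: vs).length : ℤ) - a + ((v₁ :: vs).map label).sum) (v₁ :: vs))

open Classical in
/-- The number of leaf nodes. -/
noncomputable def lnode (t : PlaneTree ℤ) : ℕ :=
  t.subtrees.countP fun v => v.children = []

open Classical in
/-- The number of zero nodes. -/
noncomputable def znode (t : PlaneTree ℤ) : ℕ :=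
  t.subtrees.countP fun v => v.children ≠ [] ∧ v.edgeLabel = 0

open Classical in
/-- The number of positive nodes. -/
noncomputable def pnode (t : PlaneTree ℤ) : ℕ :=
  t.subtrees.countP fun v => v.children ≠ [] ∧ v.edgeLabel ≠ 0

/-- The label of the root. -/
def rlabel (t : PlaneTree ℤ) : ℤ := t.label

end PlaneTree

/-! ## From maps to trees -/

open Classical in
/-- The exploration procedure. The argument `M` is what remains of the map, with the root leg at
the place where the tree drawn so far is attached to the current vertex `u`; the result is the
subtree induced by `u` that grows out of the remaining edges of `M` linked to `u`. An internal node
is decorated with the label of its leftmost descending edge. Children are found in clockwise order,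
that is from right to left.

The pending edge `e` is the one clockwise next to the root leg; if there is none, we are done at `u`
and backtrack, that is, we return from the recursive call.
* If `e` is a bridge to a vertex of degree one, it becomes the edge to the rightmost child, which
  is a leaf, and we go on at `u`.
* If `e` is a bridge to a vertex `v` of degree at least two, let `e₁ = M.white e` be the edge
  clockwise next to `e` around `v` and `w` the other end of `e₁`. The new tree edge goes from `u`
  to `w`, where it ends just after `e₁` in clockwise order. We delete `e`, explore from `w`, which
  yields the rightmost child, and then what is left at `u`.
* If `e` is not a bridge, its label is the half-degree of the face on its other side, which is the
  face with the corner at `u` just after `e`. We delete `e`; the new leftmost (here: only)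
  child of `u` takes over all the remaining edges at `u`, and we go on from there.

Each step deletes an edge, so that a bound `k` on the number of steps suffices when it is
at least the number of edges. -/
noncomputable def explore {E : Type} : ℕ → RotationSystem E → PlaneTree ℕ
  | 0, _ => .node 0 []
  | k + 1, M =>
    match M.black none with
    | none => .node 0 []
    | some e =>
      if M.IsBridge e then
        if M.white e = e then
          (explore k (M.delete e)).addRight (.node 0 [])
        else
          (explore k (M.delete e)).addRight (explore k ((M.delete e).moveRoot (M.white e)))
      else
        .node (M.halfDegree (M.black (some e))) [explore k (M.delete e)]

/-! ## From trees to maps -/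

namespace RotationSystem

/-- Here `M` is the map attached to a node `u'` so far, and `N` the map attached to its next child
`u`, whose edge `e_u` to `u'` is labelled `0`; both are rooted at the place of their upper tree
edge. The new edge `none` starts at `u'`, clockwise next to the root leg of `M`. If `N` has no edge
(`u` is a leaf), it goes to a new white vertex. Otherwise let `e'` be the edge next to `e_u`
around `u` in counterclockwise order, and `v` its other end; the new edge goes to `v`, where `e'`
is clockwise next to it. The edge `e_u` (the root leg of `N`) is deleted. -/
noncomputable def join {A B : Type} (M : RotationSystem A) (N : RotationSystem B) :
    RotationSystem (Option (A ⊕ B)) where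
  black := insertAfter
    (M.black.viaEmbedding (Function.Embedding.inl.trans .some).optionMap *
      Perm.viaEmbedding (removeNone N.black) ((Function.Embedding.inr.trans .some).trans .some))
    (some none) none
  white :=
    match N.black.symm none with
    | none => optionCongr (Perm.sumCongr M.white N.white)
    | some e' => insertBefore (optionCongr (Perm.sumCongr M.white N.white)) none (some (Sum.inr e'))

/-- Here `N` is the map attached to the leftmost child `u` of a node `u'`, rooted at the place of
the edge `e_u` from `u` to `u'`, which is labelled `m > 0`. We start from the corner at `u` just
after `e_u` in clockwise order and walk along `2 m - 1` edges of the outer face; the last one is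
`f = N.faces ^ m` applied to the root leg, walked to its white end, and we are in the corner
just after `f` in clockwise order. The new edge `none` joins these two corners and cuts off a face
of degree `2 m`. Contracting `e_u` then puts the root leg where `e_u` was. (The walk does not
meet the root leg again if `m` is at most the half-degree of the outer face of `N`.) -/
noncomputable def closeFace {A : Type} (N : RotationSystem A) (m : ℕ) :
    RotationSystem (Option A) where
  black := insertAfter (N.black.viaEmbedding (Function.Embedding.some).optionMap) (some none) none
  white :=
    match (N.faces ^ m) none with
    | none => optionCongr N.white
    | some f => insertAfter (optionCongr N.white) none (some f)

end RotationSystem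

namespace BipartiteMap

/-- The tree, with its node labels, that the exploration of `M` yields. -/
noncomputable def tree (M : BipartiteMap) : PlaneTree ℤ :=
  (explore (Nat.card M.Edge) M.rot).nodeLabels

/-- The map with one black vertex and no edge. -/
def vertexMap : BipartiteMap where
  Edge := Empty
  rot := ⟨1, 1⟩

/-- Attach the next child, by an edge labelled `0`. -/
noncomputable def addChild (M N : BipartiteMap) : BipartiteMap where
  Edge := Option (M.Edge ⊕ N.Edge)
  rot := M.rot.join N.rot

/-- Attach the first child, by an edge labelled `m > 0`. -/
noncomputable def closeFace (N : BipartiteMap) (m : ℕ) : BipartiteMap where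
  Edge := Option N.Edge
  rot := N.rot.closeFace m

open Classical in
/-- The map attached to the root of a degree tree after all other nodes have been dealt with in
postorder (the children of a node from left to right, then the node). -/
noncomputable def ofTree : PlaneTree ℤ → BipartiteMap
  | .node _ [] => vertexMap
  | .node l (c :: cs) =>
    (cs.map ofTree).foldl addChild
      (if PlaneTree.edgeLabel (.node l (c :: cs)) = 0 then addChild vertexMap (ofTree c)
        else closeFace (ofTree c) (PlaneTree.edgeLabel (.node l (c :: cs))).toNat)

end BipartiteMap

/-! ## Isomorphism classes

The exploration does not depend on the names of the edges. -/

section Invariance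

theorem detach_conj {α β : Type*} (f : α ≃ β) {π : Perm α} {π' : Perm β}
    (h : ∀ x, π' (f x) = f (π x)) (a x : α) :
    detach π' (f a) (f x) = f (detach π a x) := by
  simp only [detach, Perm.mul_apply, h, swap_apply_def]
  split_ifs <;> simp_all

theorem insertAfter_conj {α β : Type*} (f : α ≃ β) {π : Perm α} {π' : Perm β}
    (h : ∀ x, π' (f x) = f (π x)) (a b x : α) :
    insertAfter π' (f a) (f b) (f x) = f (insertAfter π a b x) := by
  simp only [insertAfter, Perm.mul_apply, swap_apply_def]
  split_ifs <;> simp_all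

theorem sameCycle_conj {α β : Type*} (f : α ≃ β) {π : Perm α} {π' : Perm β}
    (h : ∀ x, π' (f x) = f (π x)) (x y : α) :
    π'.SameCycle (f x) (f y) ↔ π.SameCycle x y := by
  have : π' = f.permCongr π := by
    ext z
    obtain ⟨z, rfl⟩ := f.surjective z
    simp [h]
  subst this
  have key : ∀ k : ℤ, ((f.permCongr π) ^ k) (f x) = f ((π ^ k) x) := by
    intro k
    have : (f.permCongr π) ^ k = f.permCongr (π ^ k) :=
      (map_zpow (permCongrHom f) π k).symm
    rw [this]; simp
  simp only [Perm.SameCycle, key, f.apply_eq_iff_eq]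

namespace RotationSystem

variable {E E' : Type} {M : RotationSystem E} {M' : RotationSystem E'} {f : E ≃ E'}

theorem IsIso.refl (M : RotationSystem E) : M.IsIso M (Equiv.refl E) := by
  constructor <;> simp

theorem IsIso.symm (h : M.IsIso M' f) : M'.IsIso M f.symm := by
  refine ⟨fun x => ?_, fun e => ?_⟩
  · have := h.1 (optionCongr f.symm x)
    have h₂ : ∀ y, optionCongr f (optionCongr f.symm y) = y := by rintro (_ | y) <;> simp
    have h₃ : ∀ y, optionCongr f.symm (optionCongr f y) = y := by
      rintro (_ | y) <;> simp only [optionCongr_apply, Option.map_none, Option.map_some,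
        Equiv.symm_apply_apply]
    rw [h₂] at this
    rw [this, h₃]
  · have := h.2 (f.symm e)
    rw [Equiv.apply_symm_apply] at this
    rw [this, Equiv.symm_apply_apply]

theorem IsIso.trans {E'' : Type} {M'' : RotationSystem E''} {g : E' ≃ E''}
    (h : M.IsIso M' f) (h' : M'.IsIso M'' g) : M.IsIso M'' (f.trans g) := by
  refine ⟨fun x => ?_, fun e => ?_⟩
  · have h₂ : ∀ y, optionCongr (f.trans g) y = optionCongr g (optionCongr f y) := by
      rintro (_ | y) <;> simp
    rw [h₂, h₂, h'.1, h.1]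
  · simp only [Equiv.trans_apply, h'.2, h.2]

theorem IsIso.delete (h : M.IsIso M' f) (e : E) : (M.delete e).IsIso (M'.delete (f e)) f :=
  ⟨fun x => detach_conj (optionCongr f) h.1 (some e) x, fun x => detach_conj f h.2 e x⟩

theorem IsIso.moveRoot (h : M.IsIso M' f) (e : E) :
    (M.moveRoot e).IsIso (M'.moveRoot (f e)) f :=
  ⟨fun x => insertAfter_conj (optionCongr f)
    (fun y => detach_conj (optionCongr f) h.1 none y) none (some e) x, h.2⟩

theorem IsIso.faces (h : M.IsIso M' f) (x : Option E) :
    M'.faces (optionCongr f x) = optionCongr f (M.faces x) := by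
  have hw : optionCongr M'.white (optionCongr f x) = optionCongr f (optionCongr M.white x) := by
    cases x <;> simp [h.2]
  simp only [RotationSystem.faces, Perm.mul_apply, hw, h.1]

theorem IsIso.halfDegree (h : M.IsIso M' f) (c : Option E) :
    M'.halfDegree (optionCongr f c) = M.halfDegree c := by
  unfold RotationSystem.halfDegree
  rw [← Set.ncard_image_of_injective {x : E | M.faces.SameCycle c (some x)} f.injective]
  congr 1
  ext y
  obtain ⟨y, rfl⟩ := f.surjective y
  have := sameCycle_conj (optionCongr f) h.faces c (some y)
  rw [optionCongr_apply, optionCongr_apply, Option.map_some] at this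
  simp [this]

theorem IsIso.linked (h : M.IsIso M' f) {S : Set E} {S' : Set E'} (hS : ∀ e ∈ S, f e ∈ S')
    {x y : Option E ⊕ E} (hxy : M.Linked S x y) :
    M'.Linked S' (Sum.map (optionCongr f) f x) (Sum.map (optionCongr f) f y) := by
  induction hxy with
  | rel x y hs =>
    refine Relation.EqvGen.rel _ _ ?_
    cases hs with
    | black x => simpa only [Sum.map_inl, h.1] using Step.black (M := M') (S := S') (optionCongr f x)
    | white e => simpa only [Sum.map_inr, h.2] using Step.white (M := M') (S := S') (f e)
    | edge e he => exact Step.edge (f e) (hS e he)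
  | refl x => exact Relation.EqvGen.refl _
  | symm x y _ ih => exact Relation.EqvGen.symm _ _ ih
  | trans x y z _ _ ih₁ ih₂ => exact Relation.EqvGen.trans _ _ _ ih₁ ih₂

theorem IsIso.isBridge (h : M.IsIso M' f) (e : E) : M'.IsBridge (f e) ↔ M.IsBridge e := by
  refine not_congr ⟨fun hl => ?_, fun hl => ?_⟩
  · have hS : ∀ g ∈ {g | g ≠ f e}, f.symm g ∈ {g | g ≠ e} := by
      rintro g hg rfl
      simp at hg
    have := h.symm.linked hS hl
    simpa only [Sum.map_inl, Sum.map_inr, optionCongr_apply, Option.map_some,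
      Equiv.symm_apply_apply] using this
  · have hS : ∀ g ∈ {g | g ≠ e}, f g ∈ {g | g ≠ f e} := fun g hg hge => hg (f.injective hge)
    exact h.linked hS hl

end RotationSystem

theorem explore_iso {E E' : Type} (k : ℕ) {M : RotationSystem E} {M' : RotationSystem E'}
    {f : E ≃ E'} (h : M.IsIso M' f) :
    explore k M' = explore k M := by
  induction k generalizing M M' with
  | zero => rfl
  | succ k ih =>
    have h0 : M'.black none = optionCongr f (M.black none) := h.1 none
    cases hM : M.black none with
    | none =>
      rw [hM] at h0
      have h0' : M'.black none = none := h0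
      simp only [explore, hM, h0']
    | some e =>
      rw [hM] at h0
      have h0' : M'.black none = some (f e) := h0
      have hd : M'.halfDegree (M'.black (some (f e))) = M.halfDegree (M.black (some e)) := by
        rw [← h.halfDegree, ← h.1]; rfl
      simp only [explore, hM, h0', h.2, ih (h.delete e),
        ih ((h.delete e).moveRoot (M.white e)), hd]
      have hb := h.isBridge e
      have hw : M'.white (f e) = f e ↔ M.white e = e := by rw [h.2, f.apply_eq_iff_eq]
      split_ifs <;> first | rfl | (exfalso; tauto)

end Invariance

/-- Two rooted maps are the same up to orientation-preserving homeomorphism (equivalently,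
continuous deformation) when their rotation systems are isomorphic. -/
instance BipartiteMap.setoid : Setoid BipartiteMap where
  r M M' := ∃ f : M.Edge ≃ M'.Edge, M.rot.IsIso M'.rot f
  iseqv :=
    { refl := fun M => ⟨_, RotationSystem.IsIso.refl M.rot⟩
      symm := fun ⟨_, h⟩ => ⟨_, h.symm⟩
      trans := fun ⟨_, h⟩ ⟨_, h'⟩ => ⟨_, h.trans h'⟩ }

/-- Rooted bipartite maps up to isomorphism. -/
def RootedMap : Type 1 := Quotient BipartiteMap.setoid

/-- The isomorphism class of a map. -/
def BipartiteMap.toRootedMap (M : BipartiteMap) : RootedMap := Quotient.mk _ M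

/-- The set of rooted bipartite planar maps with `n` edges. -/
def planarMaps (n : ℕ) : Set RootedMap :=
  {m | ∃ M : BipartiteMap, M.toRootedMap = m ∧ M.rot.IsPlanarMap ∧ Nat.card M.Edge = n}

/-- The set of degree trees with `n` edges. -/
def degreeTrees (n : ℕ) : Set (PlaneTree ℤ) := {t | t.IsDegreeTree ∧ t.size = n}

/-- The transformation from maps to trees. -/
noncomputable def treeOfMap : RootedMap → PlaneTree ℤ :=
  Quotient.lift BipartiteMap.tree fun M M' ⟨f, h⟩ => by
    rw [BipartiteMap.tree, BipartiteMap.tree, explore_iso _ h, Nat.card_congr f]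

/-- The transformation from trees to maps. -/
noncomputable def mapOfTree (t : PlaneTree ℤ) : RootedMap := (BipartiteMap.ofTree t).toRootedMap

end BipTree

/-! Planar maps and degree trees are generated from a one-vertex object by the same two operations,
and the transformations exchange these operations.

Let `e` be the edge clockwise next to the root leg of `M`. If `e` is a bridge, then `M` splits into
a map `L` on the black side and a map `R` on the white side (`IsJoin`). The root leg of `R` marks
where `e` was, so that `M` can be recovered from `L` and `R`. On trees this is `attach`: the tree of
`R` becomes a new rightmost child below the root of the tree of `L`. If `e` is not a bridge, then
`M` arises from a connected map `N` by an edge from the root corner to a corner at a white vertex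
(`IsAddEdge`). In the planar case this white corner lies on the outer face of `N`, and it is
determined by the number `m` of steps of `N.faces` that lead to it from the root leg, where `1 ≤ m ≤
N.outdeg`. On trees this is `graft`: a new root with a single descending edge, labelled `m`.

All counts reduce to the fact that multiplying a permutation by a transposition merges two cycles or
cuts one (`numCycles_insertAfter`, `sameCycle_insertAfter_pow`). Joining adds the outer half-degrees
and one more. Closing a face of half-degree `m` turns the outer half-degree `d` into `d + 1 - m`.
These are the recursions of the node labels.

From trees to maps, `attach_induction` yields `represents_ofTree`: the map of a degree tree is
planar, has the prescribed statistics, and its exploration gives the tree back. The last point needs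
that the exploration sees only what the root leg is linked to (`explore_of_isEmbedding`).

From maps to trees, induction on the number of edges shows that every planar map comes from a degree
tree (`IsPlanarMap.exists_isIso_ofTree`). That the smaller maps are again planar, and that the white
corner is on the outer face, follows by counting from the inequality `euler_le` for connected maps
of arbitrary genus. So tree-to-map is surjective and has a left inverse, hence the two
transformations are mutually inverse. -/

namespace BipTree

open Equiv

/-! ### Cycles of a permutation under multiplication by a transposition -/

section Cycles

variable {α : Type*}

theorem insertAfter_left (π : Perm α) (x y : α) : insertAfter π x y x = π y := by
  simp [insertAfter]

theorem insertAfter_right (π : Perm α) (x y : α) : insertAfter π x y y = π x := by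
  simp [insertAfter]

theorem insertAfter_of_ne (π : Perm α) {x y z : α} (hx : z ≠ x) (hy : z ≠ y) :
    insertAfter π x y z = π z := by
  simp [insertAfter, swap_apply_def, hx, hy]

theorem insertAfter_comm (π : Perm α) (x y : α) : insertAfter π x y = insertAfter π y x := by
  simp [insertAfter, swap_comm]

theorem insertAfter_insertAfter (π : Perm α) (x y : α) :
    insertAfter (insertAfter π x y) x y = π := by
  simp [insertAfter, mul_assoc]

theorem detach_self (π : Perm α) (x : α) : detach π x x = x := by
  simp [detach]

theorem detach_of_apply_eq (π : Perm α) {x y : α} (h : π y = x) : detach π x y = π x := by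
  simp [detach, h]

theorem detach_of_ne (π : Perm α) {x y : α} (hx : y ≠ x) (hy : π y ≠ x) :
    detach π x y = π y := by
  have : π y ≠ π x := fun h => hx (π.injective h)
  simp [detach, swap_apply_def, hy, this]

theorem apply_of_semiconj {β : Type*} {i : α → β} {σ : Perm α} {π : Perm β}
    (h : ∀ x, π (i x) = i (σ x)) (k : ℤ) (x : α) : (π ^ k) (i x) = i ((σ ^ k) x) := by
  have hinv : ∀ x, π⁻¹ (i x) = i (σ⁻¹ x) := fun x => by
    rw [Perm.inv_eq_iff_eq, h]; simp
  induction k with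
  | zero => simp
  | succ k ih => rw [add_comm, zpow_add, zpow_add, Perm.mul_apply, Perm.mul_apply, ih]; simp [h]
  | pred k ih =>
    rw [sub_eq_neg_add, zpow_add, zpow_add, Perm.mul_apply, Perm.mul_apply, ih]
    simp [hinv]

/-- The range of `i` is a union of cycles of `π`, on which `π` is a copy of `σ`. All comparisons
between a map and its parts go through such an `i`. -/
theorem sameCycle_of_semiconj {β : Type*} {i : α → β} (hi : Function.Injective i) {σ : Perm α}
    {π : Perm β} (h : ∀ x, π (i x) = i (σ x)) (x y : α) :
    π.SameCycle (i x) (i y) ↔ σ.SameCycle x y := by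
  simp only [Perm.SameCycle, apply_of_semiconj h, hi.eq_iff]

theorem SameCycle.exists_of_semiconj {β : Type*} {i : α → β} {σ : Perm α} {π : Perm β}
    (h : ∀ x, π (i x) = i (σ x)) {x : α} {z : β} (hz : π.SameCycle (i x) z) :
    ∃ y, z = i y := by
  obtain ⟨k, rfl⟩ := hz
  exact ⟨_, apply_of_semiconj h k x⟩

/-- Finiteness makes forward steps sufficient, so `p` need not be preserved by the inverse of `π`.
-/
theorem SameCycle.induction [Finite α] {π : Perm α} {p : α → Prop} {x y : α}
    (h : π.SameCycle x y) (hx : p x) (hstep : ∀ z, p z → p (π z)) : p y := by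
  obtain ⟨n, rfl⟩ := h.exists_nat_pow_eq
  induction n with
  | zero => simpa using hx
  | succ n ih => rw [pow_succ', Perm.mul_apply]; exact hstep _ (ih ⟨n, by simp⟩)

theorem ncard_cycle_of_semiconj {β : Type*} {i : α → β} (hi : Function.Injective i) {σ : Perm α}
    {π : Perm β} (h : ∀ x, π (i x) = i (σ x)) (x : α) :
    {z | π.SameCycle (i x) z}.ncard = {z | σ.SameCycle x z}.ncard := by
  rw [← Set.ncard_image_of_injective {z | σ.SameCycle x z} hi]
  congr 1
  ext z
  constructor
  · intro hz
    obtain ⟨y, rfl⟩ := SameCycle.exists_of_semiconj h hz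
    exact ⟨y, (sameCycle_of_semiconj hi h x y).1 hz, rfl⟩
  · rintro ⟨y, hy, rfl⟩
    exact (sameCycle_of_semiconj hi h x y).2 hy

theorem pow_injOn_minimalPeriod (π : Perm α) (x : α) {i j : ℕ}
    (hi : i < Function.minimalPeriod π x) (hj : j < Function.minimalPeriod π x)
    (h : (π ^ i) x = (π ^ j) x) : i = j := by
  rw [← Perm.iterate_eq_pow, ← Perm.iterate_eq_pow] at h
  exact Function.iterate_injOn_Iio_minimalPeriod hi hj h

variable [Finite α]

/-- The new permutation sends `x` to `π y` and from there follows the old cycle of `y` until it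
reaches `y`, so starting from `x` it visits this whole cycle. -/
theorem sameCycle_insertAfter_orbit {π : Perm α} {x y z : α} (h : ¬ π.SameCycle x y)
    (hz : π.SameCycle y z) : (insertAfter π x y).SameCycle x z := by
  have key : π.SameCycle y z ∧ (insertAfter π x y).SameCycle x z := by
    refine SameCycle.induction (x := π y)
      (p := fun z => π.SameCycle y z ∧ (insertAfter π x y).SameCycle x z)
      (Perm.sameCycle_apply_left.2 hz) ⟨Perm.sameCycle_apply_right.2 .rfl, ?_⟩ ?_
    · rw [← insertAfter_left π x y]; exact Perm.sameCycle_apply_right.2 .rfl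
    · rintro z ⟨h₁, h₂⟩
      refine ⟨by simpa using h₁, ?_⟩
      by_cases hzy : z = y
      · subst hzy; rw [← insertAfter_left π x z]; exact Perm.sameCycle_apply_right.2 .rfl
      · have hzx : z ≠ x := by rintro rfl; exact h h₁.symm
        rw [← insertAfter_of_ne π hzx hzy]; simpa using h₂
  exact key.2

/-- A transposition of points in different cycles merges these cycles. -/
theorem sameCycle_insertAfter {π : Perm α} {x y : α} (h : ¬ π.SameCycle x y) (u v : α) :
    (insertAfter π x y).SameCycle u v ↔ π.SameCycle u v ∨
      ((π.SameCycle x u ∨ π.SameCycle y u) ∧ (π.SameCycle x v ∨ π.SameCycle y v)) := by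
  have h' : ¬ π.SameCycle y x := fun h₁ => h h₁.symm
  have hy : ∀ z, π.SameCycle y z → (insertAfter π x y).SameCycle x z :=
    fun z => sameCycle_insertAfter_orbit h
  have hx : ∀ z, π.SameCycle x z → (insertAfter π x y).SameCycle y z := fun z hz => by
    rw [insertAfter_comm]; exact sameCycle_insertAfter_orbit h' hz
  have hxy : (insertAfter π x y).SameCycle x y := hy y .rfl
  have hxy' : ∀ z, π.SameCycle x z ∨ π.SameCycle y z → (insertAfter π x y).SameCycle x z := by
    rintro z (hz | hz)
    · exact hxy.trans (hx z hz)
    · exact hy z hz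
  constructor
  · intro huv
    refine SameCycle.induction huv (p := fun v => π.SameCycle u v ∨
      ((π.SameCycle x u ∨ π.SameCycle y u) ∧ (π.SameCycle x v ∨ π.SameCycle y v)))
      (Or.inl .rfl) ?_
    intro z hz
    by_cases hzx : z = x
    · subst hzx
      rw [insertAfter_left]
      refine Or.inr ⟨?_, Or.inr (Perm.sameCycle_apply_right.2 .rfl)⟩
      rcases hz with hz | hz
      · exact Or.inl hz.symm
      · exact hz.1
    · by_cases hzy : z = y
      · subst hzy
        rw [insertAfter_right]
        refine Or.inr ⟨?_, Or.inl (Perm.sameCycle_apply_right.2 .rfl)⟩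
        rcases hz with hz | hz
        · exact Or.inr hz.symm
        · exact hz.1
      · rw [insertAfter_of_ne π hzx hzy]; simpa using hz
  · rintro (huv | ⟨hu, hv⟩)
    · refine SameCycle.induction huv .rfl ?_
      intro z hz
      by_cases hzx : z = x
      · subst hzx
        exact hz.trans (hxy' _ (Or.inl (Perm.sameCycle_apply_right.2 .rfl)))
      · by_cases hzy : z = y
        · subst hzy
          exact hz.trans (hxy.symm.trans (hxy' _ (Or.inr (Perm.sameCycle_apply_right.2 .rfl))))
        · rw [← insertAfter_of_ne π hzx hzy]; simpa using hz
    · exact (hxy' u hu).symm.trans (hxy' v hv)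

/-- The merged cycle can be represented by that of `y`; hence the cycles of `π` other than that of
`x` correspond bijectively to the new cycles. -/
theorem numCycles_insertAfter {π : Perm α} {x y : α} (h : ¬ π.SameCycle x y) :
    numCycles (insertAfter π x y) + 1 = numCycles π := by
  classical
  let s := Perm.SameCycle.setoid π
  let s' := Perm.SameCycle.setoid (insertAfter π x y)
  have hs : ∀ u v, s u v ↔ π.SameCycle u v := fun _ _ => Iff.rfl
  have hs' : ∀ u v, s' u v ↔ (insertAfter π x y).SameCycle u v := fun _ _ => Iff.rfl
  let a : Quotient s := Quotient.mk s x
  let g : {q : Quotient s // q ≠ a} → Quotient s' := fun q =>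
    Quotient.map' (s₁ := s) (s₂ := s') id
      (fun u v huv => (sameCycle_insertAfter h u v).2 (Or.inl huv)) q.1
  have hg : Function.Bijective g := by
    constructor
    · rintro ⟨q, hq⟩ ⟨r, hr⟩ hqr
      induction q using Quotient.inductionOn with | _ u
      induction r using Quotient.inductionOn with | _ v
      have hu : ¬ π.SameCycle x u := fun hu => hq (Quotient.sound (s := s) hu.symm)
      have hv : ¬ π.SameCycle x v := fun hv => hr (Quotient.sound (s := s) hv.symm)
      have huv : (insertAfter π x y).SameCycle u v := Quotient.exact (s := s') hqr
      rw [sameCycle_insertAfter h] at huv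
      refine Subtype.ext (Quotient.sound (s := s) ?_)
      rcases huv with huv | ⟨h₁, h₂⟩
      · exact huv
      · exact (h₁.resolve_left hu).symm.trans (h₂.resolve_left hv)
    · intro q
      induction q using Quotient.inductionOn with | _ u
      by_cases hu : π.SameCycle x u
      · refine ⟨⟨Quotient.mk s y, fun hy => h (Quotient.exact (s := s) hy).symm⟩, ?_⟩
        exact Quotient.sound (s := s')
          ((sameCycle_insertAfter h y u).2 (Or.inr ⟨Or.inr .rfl, Or.inl hu⟩))
      · exact ⟨⟨Quotient.mk s u, fun hy => hu (Quotient.exact (s := s) hy).symm⟩, rfl⟩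
  change Nat.card (Quotient s') + 1 = Nat.card (Quotient s)
  rw [← Nat.card_congr (Equiv.ofBijective g hg), ← Finite.card_option]
  exact Nat.card_congr (Equiv.optionSubtypeNe a)

theorem minimalPeriod_pos (π : Perm α) (x : α) : 0 < Function.minimalPeriod π x := by
  obtain ⟨i, hi, -, h⟩ := (Perm.SameCycle.refl π x).exists_pow_eq''
  refine Function.IsPeriodicPt.minimalPeriod_pos hi ?_
  rw [Function.IsPeriodicPt, Function.IsFixedPt, Perm.iterate_eq_pow, h]

theorem SameCycle.exists_lt_minimalPeriod {π : Perm α} {x y : α} (h : π.SameCycle x y) :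
    ∃ i < Function.minimalPeriod π x, (π ^ i) x = y := by
  obtain ⟨n, rfl⟩ := h.exists_nat_pow_eq
  refine ⟨n % Function.minimalPeriod π x, Nat.mod_lt _ (minimalPeriod_pos π x), ?_⟩
  rw [← Perm.iterate_eq_pow, ← Perm.iterate_eq_pow, Function.iterate_mod_minimalPeriod_eq]

theorem ncard_cycle (π : Perm α) (x : α) :
    {y | π.SameCycle x y}.ncard = Function.minimalPeriod π x := by
  have : {y | π.SameCycle x y} =
      (fun i : ℕ => (π ^ i) x) '' (Finset.range (Function.minimalPeriod π x)) := by
    ext y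
    constructor
    · intro h
      obtain ⟨i, hi, rfl⟩ := SameCycle.exists_lt_minimalPeriod h
      exact ⟨i, by simpa using hi, rfl⟩
    · rintro ⟨i, -, rfl⟩
      exact Perm.sameCycle_pow_right.2 .rfl
  rw [this, Set.InjOn.ncard_image, Set.ncard_coe_finset, Finset.card_range]
  intro i hi j hj
  exact pow_injOn_minimalPeriod π x (by simpa using hi) (by simpa using hj)

/-- A transposition of two points of a cycle cuts it into two arcs. -/
theorem sameCycle_insertAfter_pow {π : Perm α} {x : α} {m : ℕ} (hm : 1 ≤ m)
    (hm' : m < Function.minimalPeriod π x) (z : α) :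
    (insertAfter π x ((π ^ m) x)).SameCycle ((π ^ m) x) z ↔
      ∃ i, 1 ≤ i ∧ i ≤ m ∧ (π ^ i) x = z := by
  constructor
  · intro h
    refine SameCycle.induction h (p := fun z => ∃ i, 1 ≤ i ∧ i ≤ m ∧ (π ^ i) x = z)
      ⟨m, hm, le_rfl, rfl⟩ ?_
    rintro _ ⟨i, hi, him, rfl⟩
    -- At the end `i = m` of the arc the new permutation jumps back to `π x`; inside the arc it
    -- agrees with `π`.
    rcases him.eq_or_lt with rfl | him
    · exact ⟨1, le_rfl, hi, by simp [insertAfter_right]⟩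
    · refine ⟨i + 1, by omega, him, ?_⟩
      rw [insertAfter_of_ne, pow_succ', Perm.mul_apply]
      · intro h
        have := pow_injOn_minimalPeriod π x (i := i) (j := 0) (by omega) (by omega) (by simpa)
        omega
      · intro h
        have := pow_injOn_minimalPeriod π x (by omega) (by omega) h
        omega
  · rintro ⟨i, hi, him, rfl⟩
    induction i, hi using Nat.le_induction with
    | base =>
      have : (π ^ 1) x = insertAfter π x ((π ^ m) x) ((π ^ m) x) := by simp [insertAfter_right]
      rw [this]; exact Perm.sameCycle_apply_right.2 .rfl
    | succ i hi ih =>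
      have : (π ^ (i + 1)) x = insertAfter π x ((π ^ m) x) ((π ^ i) x) := by
        rw [insertAfter_of_ne, pow_succ', Perm.mul_apply]
        · intro h
          have := pow_injOn_minimalPeriod π x (i := i) (j := 0) (by omega) (by omega) (by simpa)
          omega
        · intro h
          have := pow_injOn_minimalPeriod π x (by omega) (by omega) h
          omega
      rw [this, Perm.sameCycle_apply_right]
      exact ih (by omega)

theorem not_sameCycle_insertAfter {π : Perm α} {x y : α} (hxy : x ≠ y) (h : π.SameCycle x y) :
    ¬ (insertAfter π x y).SameCycle x y := by
  obtain ⟨m, hm, rfl⟩ := SameCycle.exists_lt_minimalPeriod h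
  have hm₁ : 1 ≤ m := by
    rcases Nat.eq_zero_or_pos m with rfl | h
    · simp at hxy
    · exact h
  intro h'
  obtain ⟨i, hi, him, h⟩ := (sameCycle_insertAfter_pow hm₁ hm x).1 h'.symm
  have := pow_injOn_minimalPeriod π x (i := i) (j := 0) (by omega) (by omega) (by simpa)
  omega

/-- Cutting is undone by merging, since multiplying twice by the same transposition changes nothing.
-/
theorem numCycles_insertAfter_of_sameCycle {π : Perm α} {x y : α} (hxy : x ≠ y)
    (h : π.SameCycle x y) : numCycles (insertAfter π x y) = numCycles π + 1 := by
  have := numCycles_insertAfter (not_sameCycle_insertAfter hxy h)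
  rw [insertAfter_insertAfter] at this
  exact this.symm

theorem ncard_cycle_insertAfter_pow {π : Perm α} {x : α} {m : ℕ} (hm : 1 ≤ m)
    (hm' : m < Function.minimalPeriod π x) :
    {z | (insertAfter π x ((π ^ m) x)).SameCycle ((π ^ m) x) z}.ncard = m := by
  have : {z | (insertAfter π x ((π ^ m) x)).SameCycle ((π ^ m) x) z} =
      (fun i : ℕ => (π ^ i) x) '' (Finset.Icc 1 m) := by
    ext y
    simp [sameCycle_insertAfter_pow hm hm', and_assoc]
  rw [this, Set.InjOn.ncard_image, Set.ncard_coe_finset, Nat.card_Icc, Nat.add_sub_cancel]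
  intro i hi j hj
  simp only [Finset.coe_Icc, Set.mem_Icc] at hi hj
  exact pow_injOn_minimalPeriod π x (by omega) (by omega)

theorem ncard_cycle_insertAfter {π : Perm α} {x y : α} (h : ¬ π.SameCycle x y) :
    {z | (insertAfter π x y).SameCycle x z}.ncard =
      {z | π.SameCycle x z}.ncard + {z | π.SameCycle y z}.ncard := by
  rw [← Set.ncard_union_eq]
  · congr 1
    ext z
    simp only [Set.mem_ofPred_eq, sameCycle_insertAfter h, Set.mem_union, Perm.SameCycle.rfl,
      true_or, true_and]
    tauto
  · rw [Set.disjoint_left]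
    exact fun z h₁ h₂ => h (Perm.SameCycle.trans h₁ (Perm.SameCycle.symm h₂))

end Cycles

/-! ### Counting cycles of permutations assembled from parts -/

section NumCycles

variable {α β γ : Type*}

theorem numCycles_sum [Finite α] [Finite β] {i : α → γ} {j : β → γ}
    (hij : Function.Bijective (Sum.elim i j)) {σ : Perm α} {τ : Perm β} {π : Perm γ}
    (hi : ∀ x, π (i x) = i (σ x)) (hj : ∀ x, π (j x) = j (τ x)) :
    numCycles π = numCycles σ + numCycles τ := by
  have ii : Function.Injective i := fun x y h => Sum.inl_injective (hij.1 h)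
  have ji : Function.Injective j := fun x y h => Sum.inr_injective (hij.1 h)
  have hd : ∀ a b, i a ≠ j b := fun a b h => Sum.inl_ne_inr (hij.1 h)
  unfold numCycles
  rw [← Nat.card_sum]
  symm
  let s := Perm.SameCycle.setoid π
  let s₁ := Perm.SameCycle.setoid σ
  let s₂ := Perm.SameCycle.setoid τ
  let g : Quotient s₁ ⊕ Quotient s₂ → Quotient s := Sum.elim
    (Quotient.map' i fun x y h => (sameCycle_of_semiconj ii hi x y).2 h)
    (Quotient.map' j fun x y h => (sameCycle_of_semiconj ji hj x y).2 h)
  refine Nat.card_congr (Equiv.ofBijective g ⟨?_, ?_⟩)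
  · rintro (q | q) (r | r) h <;>
      induction q using Quotient.inductionOn with | _ u <;>
      induction r using Quotient.inductionOn with | _ v <;>
      replace h := Quotient.exact (s := s) h
    · exact congrArg _ (Quotient.sound (s := s₁) ((sameCycle_of_semiconj ii hi u v).1 h))
    · obtain ⟨y, hy⟩ := SameCycle.exists_of_semiconj hi h
      exact absurd hy.symm (hd y v)
    · obtain ⟨y, hy⟩ := SameCycle.exists_of_semiconj hj h
      exact absurd hy (hd v y)
    · exact congrArg _ (Quotient.sound (s := s₂) ((sameCycle_of_semiconj ji hj u v).1 h))
  · intro q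
    induction q using Quotient.inductionOn with | _ u
    obtain ⟨x | x, rfl⟩ := hij.2 u
    · exact ⟨Sum.inl (Quotient.mk s₁ x), rfl⟩
    · exact ⟨Sum.inr (Quotient.mk s₂ x), rfl⟩

theorem numCycles_congr {f : α ≃ β} {σ : Perm α} {π : Perm β} (h : ∀ x, π (f x) = f (σ x)) :
    numCycles π = numCycles σ :=
  (Nat.card_congr (Quotient.congr f fun x y => (sameCycle_conj f h x y).symm)).symm

theorem numCycles_of_subsingleton [Nonempty α] [Subsingleton α] (σ : Perm α) :
    numCycles σ = 1 := by
  have : Nonempty (Quotient (Perm.SameCycle.setoid σ)) := ⟨Quotient.mk _ (Classical.arbitrary α)⟩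
  exact Nat.card_eq_one_iff_unique.2 ⟨inferInstance, this⟩

theorem numCycles_of_isEmpty [IsEmpty α] (σ : Perm α) : numCycles σ = 0 := by
  have : IsEmpty (Quotient (Perm.SameCycle.setoid σ)) := ⟨fun q => isEmptyElim q.out⟩
  exact Nat.card_of_isEmpty

/-- Adding a fixed point adds a cycle. -/
theorem numCycles_add_fixedPoint [Finite α] {i : α → γ} (hi : Function.Injective i) {c : γ}
    (hc : ∀ z, z = c ∨ ∃ x, z = i x) (hc' : ∀ x, i x ≠ c) {σ : Perm α} {π : Perm γ}
    (h : ∀ x, π (i x) = i (σ x)) (hπ : π c = c) : numCycles π = numCycles σ + 1 := by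
  rw [← numCycles_of_subsingleton (1 : Perm Unit)]
  refine numCycles_sum (i := i) (j := fun _ : Unit => c) ⟨?_, fun z => ?_⟩ h fun _ => hπ
  · exact hi.sumElim (fun _ _ _ => rfl) fun x _ => hc' x
  · rcases hc z with rfl | ⟨x, rfl⟩
    · exact ⟨Sum.inr (), rfl⟩
    · exact ⟨Sum.inl x, rfl⟩

end NumCycles

/-! ### Linked half-edges and the locality of the exploration -/

theorem detach_of_semiconj {α β : Type*} {i : α → β} (hi : Function.Injective i) {σ : Perm α}
    {π : Perm β} (h : ∀ x, π (i x) = i (σ x)) (a x : α) :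
    detach π (i a) (i x) = i (detach σ a x) := by
  simp only [detach, Perm.mul_apply, h, swap_apply_def]
  split_ifs <;> simp_all [hi.eq_iff]

theorem insertAfter_of_semiconj {α β : Type*} {i : α → β} (hi : Function.Injective i)
    {σ : Perm α} {π : Perm β} (h : ∀ x, π (i x) = i (σ x)) (a b x : α) :
    insertAfter π (i a) (i b) (i x) = i (insertAfter σ a b x) := by
  simp only [insertAfter, Perm.mul_apply, swap_apply_def]
  split_ifs <;> simp_all [hi.eq_iff]

namespace RotationSystem

/-- This is the tool for showing that half-edges are not linked: it suffices to find a property that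
every elementary link preserves in both directions and that separates them. -/
theorem Linked.iff {E : Type} {M : RotationSystem E} {S : Set E} {p : Option E ⊕ E → Prop}
    {x y : Option E ⊕ E} (h : M.Linked S x y)
    (hb : ∀ x, p (Sum.inl x) ↔ p (Sum.inl (M.black x)))
    (hw : ∀ e, p (Sum.inr e) ↔ p (Sum.inr (M.white e)))
    (he : ∀ e ∈ S, p (Sum.inl (some e)) ↔ p (Sum.inr e)) : p x ↔ p y := by
  induction h with
  | rel x y hs =>
    cases hs with
    | black x => exact hb x
    | white e => exact hw e
    | edge e h => exact he e h
  | refl x => exact Iff.rfl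
  | symm x y _ ih => exact ih.symm
  | trans x y z _ _ ih₁ ih₂ => exact ih₁.trans ih₂

section Linked

variable {E : Type} {M : RotationSystem E} {S : Set E} {x y z : Option E ⊕ E}

theorem Linked.rfl : M.Linked S x x := .refl _

theorem Linked.symm (h : M.Linked S x y) : M.Linked S y x := Relation.EqvGen.symm _ _ h

theorem Linked.trans (h : M.Linked S x y) (h' : M.Linked S y z) : M.Linked S x z :=
  Relation.EqvGen.trans _ _ _ h h'

variable (M S)

theorem linked_black (x : Option E) : M.Linked S (Sum.inl x) (Sum.inl (M.black x)) :=
  .rel _ _ (.black x)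

theorem linked_white (e : E) : M.Linked S (Sum.inr e) (Sum.inr (M.white e)) :=
  .rel _ _ (.white e)

variable {S}

theorem linked_edge {e : E} (he : e ∈ S) : M.Linked S (Sum.inl (some e)) (Sum.inr e) :=
  .rel _ _ (.edge e he)

variable {M}

/-- Linkedness is transported by a map of half-edges that sends elementary links to links. -/
theorem Linked.map {F : Type} {N : RotationSystem F} {T : Set F} (g : Option E ⊕ E → Option F ⊕ F)
    (h : M.Linked S x y)
    (hb : ∀ x, N.Linked T (g (Sum.inl x)) (g (Sum.inl (M.black x))))
    (hw : ∀ e, N.Linked T (g (Sum.inr e)) (g (Sum.inr (M.white e))))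
    (he : ∀ e ∈ S, N.Linked T (g (Sum.inl (some e))) (g (Sum.inr e))) :
    N.Linked T (g x) (g y) := by
  induction h with
  | rel x y hs =>
    cases hs with
    | black x => exact hb x
    | white e => exact hw e
    | edge e h => exact he e h
  | refl x => exact .refl _
  | symm x y _ ih => exact ih.symm
  | trans x y z _ _ ih₁ ih₂ => exact ih₁.trans ih₂

end Linked

/-- The rotation system `N` sits inside `M` as a union of vertices that contains the root leg. -/
structure IsEmbedding {A E : Type} (N : RotationSystem A) (M : RotationSystem E) (i : A → E) :
    Prop where
  inj : Function.Injective i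
  black : ∀ x, M.black (x.map i) = (N.black x).map i
  white : ∀ a, M.white (i a) = i (N.white a)

namespace IsEmbedding

variable {A E : Type} {N : RotationSystem A} {M : RotationSystem E} {i : A → E}

theorem delete (h : IsEmbedding N M i) (a : A) : IsEmbedding (N.delete a) (M.delete (i a)) i :=
  ⟨h.inj, fun x => detach_of_semiconj (Option.map_injective h.inj) h.black (some a) x,
    fun x => detach_of_semiconj h.inj h.white a x⟩

theorem moveRoot (h : IsEmbedding N M i) (a : A) :
    IsEmbedding (N.moveRoot a) (M.moveRoot (i a)) i :=
  ⟨h.inj, fun x => insertAfter_of_semiconj (Option.map_injective h.inj)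
    (fun y => detach_of_semiconj (Option.map_injective h.inj) h.black none y) none (some a) x,
    h.white⟩

theorem faces (h : IsEmbedding N M i) (x : Option A) : M.faces (x.map i) = (N.faces x).map i := by
  have hw : optionCongr M.white (x.map i) = (optionCongr N.white x).map i := by
    cases x <;> simp [h.white]
  simp only [RotationSystem.faces, Perm.mul_apply, hw, h.black]

theorem halfDegree (h : IsEmbedding N M i) (c : Option A) :
    M.halfDegree (c.map i) = N.halfDegree c := by
  unfold RotationSystem.halfDegree
  rw [← Set.ncard_image_of_injective {x : A | N.faces.SameCycle c (some x)} h.inj]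
  congr 1
  ext y
  have hs := fun x => sameCycle_of_semiconj (Option.map_injective h.inj) h.faces c x
  constructor
  · intro hy
    obtain ⟨_ | z, hz⟩ := SameCycle.exists_of_semiconj h.faces hy
    · simp at hz
    · obtain rfl : y = i z := by simpa using hz
      exact ⟨z, (hs (some z)).1 hy, rfl⟩
  · rintro ⟨z, hz, rfl⟩
    exact (hs (some z)).2 hz

theorem linked_map (h : IsEmbedding N M i) {S : Set A} {T : Set E} (hS : ∀ a ∈ S, i a ∈ T)
    {x y : Option A ⊕ A} (hxy : N.Linked S x y) :
    M.Linked T (Sum.map (Option.map i) i x) (Sum.map (Option.map i) i y) := by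
  refine hxy.map _ (fun x => ?_) (fun a => ?_) fun a ha => linked_edge M (hS a ha)
  · simpa only [Sum.map_inl, ← h.black] using linked_black M T _
  · simpa only [Sum.map_inr, ← h.white] using linked_white M T _

/-- No elementary link of `M` leaves the image of `N`, so a chain of links that starts there can be
pulled back. -/
theorem linked_iff (h : IsEmbedding N M i) {S : Set A} {T : Set E} (hS : ∀ a, a ∈ S ↔ i a ∈ T)
    (x y : Option A ⊕ A) :
    M.Linked T (Sum.map (Option.map i) i x) (Sum.map (Option.map i) i y) ↔ N.Linked S x y := by
  refine ⟨fun hxy => ?_, h.linked_map fun a => (hS a).1⟩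
  have hinj : Function.Injective (Sum.map (Option.map i) i) :=
    (Option.map_injective h.inj).sumMap h.inj
  have key := hxy.iff (p := fun z => ∃ y, z = Sum.map (Option.map i) i y ∧ N.Linked S x y)
    ?_ ?_ ?_
  · obtain ⟨y', hy, h'⟩ := key.1 ⟨x, rfl, .rfl⟩
    rwa [hinj hy]
  · intro z
    constructor
    · rintro ⟨y | y, hy, hl⟩
      · obtain rfl : z = y.map i := by simpa using hy
        exact ⟨Sum.inl (N.black y), by simp [h.black], hl.trans (linked_black N S y)⟩
      · simp at hy
    · rintro ⟨y | y, hy, hl⟩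
      · have hy : M.black z = y.map i := by simpa using hy
        have hz : z = (N.black.symm y).map i := by
          apply M.black.injective; rw [h.black, hy]; simp
        refine ⟨Sum.inl (N.black.symm y), by simp [hz], hl.trans (Linked.symm ?_)⟩
        simpa using linked_black N S (N.black.symm y)
      · simp at hy
  · intro z
    constructor
    · rintro ⟨y | y, hy, hl⟩
      · simp at hy
      · obtain rfl : z = i y := by simpa using hy
        exact ⟨Sum.inr (N.white y), by simp [h.white], hl.trans (linked_white N S y)⟩
    · rintro ⟨y | y, hy, hl⟩
      · simp at hy
      · have hy : M.white z = i y := by simpa using hy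
        have hz : z = i (N.white.symm y) := by
          apply M.white.injective; rw [h.white, hy]; simp
        refine ⟨Sum.inr (N.white.symm y), by simp [hz], hl.trans (Linked.symm ?_)⟩
        simpa using linked_white N S (N.white.symm y)
  · intro e he
    constructor
    · rintro ⟨(_ | y) | y, hy, hl⟩
      · simp at hy
      · obtain rfl : e = i y := by simpa using hy
        exact ⟨Sum.inr y, rfl, hl.trans (linked_edge N ((hS y).2 he))⟩
      · simp at hy
    · rintro ⟨y | y, hy, hl⟩
      · simp at hy
      · obtain rfl : e = i y := by simpa using hy
        exact ⟨Sum.inl (some y), rfl, hl.trans (linked_edge N ((hS y).2 he)).symm⟩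

theorem isBridge (h : IsEmbedding N M i) (a : A) : M.IsBridge (i a) ↔ N.IsBridge a :=
  not_congr (h.linked_iff (S := {f | f ≠ a}) (T := {f | f ≠ i a})
    (fun b => (h.inj.ne_iff (x := b) (y := a)).symm) (Sum.inl (some a)) (Sum.inr a))

end IsEmbedding

/-- Deletion keeps the type of edges, so what remains of a map still contains deleted edges and
parts cut off from the root leg. The exploration consults only data that embeddings preserve, and
the rest can be discarded. -/
theorem explore_of_isEmbedding {A E : Type} (k : ℕ) {N : RotationSystem A}
    {M : RotationSystem E} {i : A → E} (h : IsEmbedding N M i) : explore k M = explore k N := by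
  induction k generalizing M N with
  | zero => rfl
  | succ k ih =>
    have h0 : M.black none = (N.black none).map i := h.black none
    cases hN : N.black none with
    | none =>
      rw [hN] at h0
      have h0' : M.black none = none := h0
      simp only [explore, hN, h0']
    | some e =>
      rw [hN] at h0
      have h0' : M.black none = some (i e) := h0
      have hd : M.halfDegree (M.black (some (i e))) = N.halfDegree (N.black (some e)) := by
        rw [← h.halfDegree, ← h.black]; rfl
      simp only [explore, hN, h0', h.white, ih (h.delete e),
        ih ((h.delete e).moveRoot (N.white e)), hd]
      have hb := h.isBridge e
      have hw : M.white (i e) = i e ↔ N.white e = e := by rw [h.white, h.inj.eq_iff]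
      split_ifs <;> first | rfl | (exfalso; tauto)

theorem explore_of_black_none {E : Type} (k : ℕ) {M : RotationSystem E} (h : M.black none = none) :
    explore k M = .node 0 [] := by
  cases k with
  | zero => rfl
  | succ k => simp only [explore, h]

/-! ### The outer face and connectedness seen from the root leg -/

/-- The extra one is the root leg, which lies on the outer cycle but is not a corner counted by the
half-degree. -/
theorem ncard_faces_none {E : Type} [Finite E] (M : RotationSystem E) :
    {z | M.faces.SameCycle none z}.ncard = M.outdeg + 1 := by
  have : {z | M.faces.SameCycle none z} =
      insert none (some '' {x : E | M.faces.SameCycle none (some x)}) := by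
    ext (_ | z)
    · simp only [Set.mem_ofPred_eq, Set.mem_insert_iff, true_or, iff_true]; exact .rfl
    · simp
  rw [this, Set.ncard_insert_of_notMem (by simp),
    Set.ncard_image_of_injective _ (Option.some_injective E)]
  rfl

theorem ncard_faces_some {E : Type} {M : RotationSystem E} {c : Option E}
    (h : ¬ M.faces.SameCycle c none) : {z | M.faces.SameCycle c z}.ncard = M.halfDegree c := by
  have : {z | M.faces.SameCycle c z} = some '' {x : E | M.faces.SameCycle c (some x)} := by
    ext (_ | z)
    · simpa using h
    · simp
  rw [this, Set.ncard_image_of_injective _ (Option.some_injective E)]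
  rfl

@[simp]
theorem faces_none {E : Type} (M : RotationSystem E) : M.faces none = M.black none := by
  simp [faces]

@[simp]
theorem faces_some {E : Type} (M : RotationSystem E) (e : E) :
    M.faces (some e) = M.black (some (M.white e)) := by
  simp [faces]

theorem minimalPeriod_faces_none {E : Type} [Finite E] (M : RotationSystem E) :
    Function.minimalPeriod M.faces none = M.outdeg + 1 := by
  rw [← ncard_cycle, ncard_faces_none]

theorem connected_iff_root {E : Type} {M : RotationSystem E} :
    M.Connected ↔ ∀ e, M.Linked Set.univ (Sum.inl none) (Sum.inl (some e)) := by
  refine ⟨fun h e => h _ _, fun h => ?_⟩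
  have : ∀ x, M.Linked Set.univ (Sum.inl none) x := by
    rintro ((_ | e) | e)
    · exact .rfl
    · exact h e
    · exact (h e).trans (linked_edge M (Set.mem_univ e))
  exact fun x y => (this x).symm.trans (this y)

theorem isEmpty_of_connected {E : Type} {M : RotationSystem E} (h : M.Connected)
    (h0 : M.black none = none) : IsEmpty E := by
  refine ⟨fun e => ?_⟩
  have := (h (Sum.inl none) (Sum.inr e)).iff (p := fun z => z = Sum.inl none)
    (fun x => by
      constructor
      · rintro h; obtain rfl : x = none := by simpa using h
        rw [h0]
      · rintro h; rw [Sum.inl.injEq, ← h0] at h; rw [M.black.injective h])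
    (fun x => by simp) (fun x => by simp)
  simp at this

theorem outdeg_of_black_none {E : Type} {M : RotationSystem E} (h0 : M.black none = none) :
    M.outdeg = 0 := by
  have : {x : E | M.faces.SameCycle none (some x)} = ∅ := by
    ext x
    simp only [Set.mem_ofPred_eq, Set.mem_empty_iff_false, iff_false]
    intro h
    have := h.eq_of_left (by simp [Function.IsFixedPt, h0])
    simp at this
  rw [outdeg, RotationSystem.halfDegree, this, Set.ncard_empty]

end RotationSystem

/-! ### Adding an edge at the root corner -/

namespace RotationSystem

/-- `M` arises from `N` by a new edge `e`, whose black half is clockwise next to the root leg and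
whose white half is clockwise next to the white half of `f`. -/
structure IsAddEdge {A E : Type} (N : RotationSystem A) (M : RotationSystem E) (i : A → E) (e : E)
    (f : A) : Prop where
  inj : Function.Injective i
  ne : ∀ a, i a ≠ e
  cover : ∀ x, x = e ∨ ∃ a, x = i a
  black_none : M.black none = some e
  black_new : M.black (some e) = (N.black none).map i
  black_old : ∀ a, M.black (some (i a)) = (N.black (some a)).map i
  white_f : M.white (i f) = e
  white_new : M.white e = i (N.white f)
  white_old : ∀ a, a ≠ f → M.white (i a) = i (N.white a)

namespace IsAddEdge

variable {A E : Type} {N : RotationSystem A} {M : RotationSystem E} {i : A → E} {e : E} {f : A}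

theorem bijective (h : IsAddEdge N M i e f) :
    Function.Bijective fun x : Option A => x.elim e i := by
  refine ⟨?_, fun x => ?_⟩
  · rintro (_ | a) (_ | b) hab
    · rfl
    · exact absurd hab.symm (h.ne b)
    · exact absurd hab (h.ne a)
    · exact congrArg some (h.inj hab)
  · rcases h.cover x with rfl | ⟨a, rfl⟩
    · exact ⟨none, rfl⟩
    · exact ⟨some a, rfl⟩

theorem finite [Finite A] (h : IsAddEdge N M i e f) : Finite E :=
  Finite.of_surjective _ h.bijective.2

theorem card [Finite A] (h : IsAddEdge N M i e f) : Nat.card E = Nat.card A + 1 := by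
  rw [← Finite.card_option]
  exact (Nat.card_congr (Equiv.ofBijective _ h.bijective)).symm

/-- Where a half of `e` separates two neighbours of `N` around a vertex, one passes over that half
in two rotation steps; the edge `e` itself is never traversed. -/
theorem linked_of_linked (h : IsAddEdge N M i e f) {x y : Option A ⊕ A}
    (hxy : N.Linked Set.univ x y) :
    M.Linked {g | g ≠ e} (Sum.map (Option.map i) i x) (Sum.map (Option.map i) i y) := by
  refine hxy.map _ (fun x => ?_) (fun a => ?_) fun a _ => linked_edge M (h.ne a)
  · rcases x with _ | a
    · simp only [Sum.map_inl, ← h.black_new, Option.map_none]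
      have := linked_black M {g | g ≠ e} none
      rw [h.black_none] at this
      exact this.trans (linked_black M _ _)
    · simpa only [Sum.map_inl, Option.map_some, ← h.black_old] using linked_black M _ _
  · simp only [Sum.map_inr]
    by_cases ha : a = f
    · subst ha
      have := linked_white M {g | g ≠ e} (i a)
      rw [h.white_f] at this
      rw [← h.white_new]
      exact this.trans (linked_white M _ _)
    · rw [← h.white_old a ha]; exact linked_white M _ _

theorem linked_root (h : IsAddEdge N M i e f) :
    M.Linked {g | g ≠ e} (Sum.inl none) (Sum.inl (some e)) := by
  simpa only [h.black_none] using linked_black M {g | g ≠ e} none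

/-- The black half of `e` sits next to the root leg, its white half next to that of `f`, and `N`
links these two without `e`. -/
theorem not_isBridge (h : IsAddEdge N M i e f) (hN : N.Connected) : ¬ M.IsBridge e := by
  rw [IsBridge, not_not]
  refine h.linked_root.symm.trans ((h.linked_of_linked (hN (Sum.inl none) (Sum.inr f))).trans ?_)
  simpa only [h.white_f, Sum.map_inr] using linked_white M {g | g ≠ e} (i f)

theorem connected (h : IsAddEdge N M i e f) (hN : N.Connected) : M.Connected := by
  have mono : ∀ {x y}, M.Linked {g | g ≠ e} x y → M.Linked Set.univ x y := fun hxy =>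
    hxy.map id (fun x => linked_black M _ _) (fun x => linked_white M _ _)
      fun x _ => linked_edge M (Set.mem_univ x)
  rw [connected_iff_root]
  intro x
  rcases h.cover x with rfl | ⟨a, rfl⟩
  · exact mono h.linked_root
  · exact mono (h.linked_of_linked (hN (Sum.inl none) (Sum.inl (some a))))

theorem isEmbedding_delete (h : IsAddEdge N M i e f) : IsEmbedding N (M.delete e) i := by
  refine ⟨h.inj, ?_, fun a => ?_⟩
  · rintro (_ | a)
    · simp only [delete, Option.map_none]
      rw [detach_of_apply_eq _ h.black_none, h.black_new]
    · simp only [delete, Option.map_some]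
      rw [detach_of_ne, h.black_old]
      · simpa using h.ne a
      · rw [← h.black_none, M.black.injective.ne_iff]; simp
  · simp only [delete]
    by_cases ha : a = f
    · subst ha
      rw [detach_of_apply_eq _ h.white_f, h.white_new]
    · rw [detach_of_ne _ (h.ne a), h.white_old a ha]
      rw [← h.white_f, M.white.injective.ne_iff, h.inj.ne_iff]; exact ha

theorem cover_option (h : IsAddEdge N M i e f) (z : Option E) :
    z = some e ∨ ∃ x : Option A, z = x.map i := by
  rcases z with _ | z
  · exact Or.inr ⟨none, rfl⟩
  · rcases h.cover z with rfl | ⟨a, rfl⟩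
    · exact Or.inl rfl
    · exact Or.inr ⟨some a, rfl⟩

theorem map_ne (h : IsAddEdge N M i e f) (x : Option A) : x.map i ≠ some e := by
  cases x <;> simp [h.ne]

/-- The faces after adding an edge: first the face with the root corner is cut or merged with the
other face involved, then the new edge is inserted. -/
theorem exists_faces (h : IsAddEdge N M i e f) :
    ∃ φ : Perm (Option E), φ (some e) = some e ∧ (∀ x : Option A, φ (x.map i) = (N.faces x).map i) ∧
      M.faces = insertAfter (insertAfter φ none (some (i f))) (some e) none := by
  -- The witness is `M.faces` with the two transpositions undone in reverse order.
  refine ⟨insertAfter (insertAfter M.faces (some e) none) none (some (i f)), ?_, ?_, ?_⟩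
  · rw [insertAfter_of_ne _ (by simp) (by simpa using (h.ne f).symm), insertAfter_left]
    simp [h.black_none]
  · rintro (_ | a)
    · rw [Option.map_none, insertAfter_left,
        insertAfter_of_ne _ (by simpa using (h.ne f)) (by simp)]
      simp [h.white_f, h.black_new]
    · rw [Option.map_some]
      by_cases ha : a = f
      · subst ha
        rw [insertAfter_right, insertAfter_right]
        simp [h.white_new, h.black_old]
      · rw [insertAfter_of_ne _ (by simp) (by simpa [h.inj.eq_iff] using ha),
          insertAfter_of_ne _ (by simpa using (h.ne a)) (by simp)]
        simp [h.white_old a ha, h.black_old]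
  · rw [insertAfter_insertAfter, insertAfter_insertAfter]

variable [Finite A]

theorem numWhite (h : IsAddEdge N M i e f) : M.numWhite = N.numWhite := by
  have := h.finite
  set ω := insertAfter M.white e (i f) with hω
  have he : ω e = e := by rw [hω, insertAfter_left, h.white_f]
  have hold : ∀ a, ω (i a) = i (N.white a) := fun a => by
    by_cases ha : a = f
    · subst ha; rw [hω, insertAfter_right, h.white_new]
    · rw [hω, insertAfter_of_ne _ (h.ne a) (h.inj.ne ha), h.white_old a ha]
  have h₁ : numCycles ω = N.numWhite + 1 :=
    numCycles_add_fixedPoint h.inj h.cover h.ne hold he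
  have h₂ : ¬ ω.SameCycle e (i f) := fun hs => h.ne f (hs.eq_of_left he).symm
  have h₃ := numCycles_insertAfter h₂
  rw [show insertAfter ω e (i f) = M.white from insertAfter_insertAfter _ _ _] at h₃
  change M.numWhite + 1 = _ at h₃
  omega

theorem numBlack (h : IsAddEdge N M i e f) : M.numBlack = N.numBlack := by
  have := h.finite
  set β := insertAfter M.black (some e) none with hβ
  have he : β (some e) = some e := by rw [hβ, insertAfter_left, h.black_none]
  have hold : ∀ x : Option A, β (x.map i) = (N.black x).map i := by
    rintro (_ | a)
    · rw [Option.map_none, hβ, insertAfter_right, h.black_new]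
    · rw [Option.map_some, hβ, insertAfter_of_ne _ (by simpa using h.ne a) (by simp), h.black_old]
  have h₁ : numCycles β = N.numBlack + 1 :=
    numCycles_add_fixedPoint (Option.map_injective h.inj) h.cover_option h.map_ne hold he
  have h₂ : ¬ β.SameCycle (some e) none := fun hs => by simpa using hs.eq_of_left he
  have h₃ := numCycles_insertAfter h₂
  rw [show insertAfter β (some e) none = M.black from insertAfter_insertAfter _ _ _] at h₃
  change M.numBlack + 1 = _ at h₃
  omega

theorem numFaces_of_sameCycle (h : IsAddEdge N M i e f) (hf : N.faces.SameCycle none (some f)) :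
    M.numFaces = N.numFaces + 1 := by
  have := h.finite
  obtain ⟨φ, he, hold, hM⟩ := h.exists_faces
  have h₁ : numCycles φ = N.numFaces + 1 :=
    numCycles_add_fixedPoint (Option.map_injective h.inj) h.cover_option h.map_ne hold he
  have h₂ : φ.SameCycle none (some (i f)) :=
    (sameCycle_of_semiconj (Option.map_injective h.inj) hold none (some f)).2 hf
  have h₃ := numCycles_insertAfter_of_sameCycle (by simp) h₂
  have h₄ : ¬ (insertAfter φ none (some (i f))).SameCycle (some e) none := fun hs => by
    have := hs.eq_of_left (by
      rw [Function.IsFixedPt, insertAfter_of_ne _ (by simp) (by simpa using (h.ne f).symm), he])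
    simp at this
  have h₅ := numCycles_insertAfter h₄
  rw [← hM] at h₅
  change M.numFaces + 1 = _ at h₅
  omega

theorem numFaces_of_not_sameCycle (h : IsAddEdge N M i e f)
    (hf : ¬ N.faces.SameCycle none (some f)) : M.numFaces + 1 = N.numFaces := by
  have := h.finite
  obtain ⟨φ, he, hold, hM⟩ := h.exists_faces
  have h₁ : numCycles φ = N.numFaces + 1 :=
    numCycles_add_fixedPoint (Option.map_injective h.inj) h.cover_option h.map_ne hold he
  have h₂ : ¬ φ.SameCycle none (some (i f)) := fun hs => hf
    ((sameCycle_of_semiconj (Option.map_injective h.inj) hold none (some f)).1 hs)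
  have h₃ := numCycles_insertAfter h₂
  have h₄ : ¬ (insertAfter φ none (some (i f))).SameCycle (some e) none := fun hs => by
    have := hs.eq_of_left (by
      rw [Function.IsFixedPt, insertAfter_of_ne _ (by simp) (by simpa using (h.ne f).symm), he])
    simp at this
  have h₅ := numCycles_insertAfter h₄
  rw [← hM] at h₅
  change M.numFaces + 1 = _ at h₅
  omega

/-- The outer cycle of `N` has `N.outdeg + 1` elements, the root leg included. The transposition
cuts off the arc of the `m` elements that follow the root leg and end in `f`, which becomes the
inner face; the new edge then joins the remaining arc. -/
theorem degrees {m : ℕ} (h : IsAddEdge N M i e f) (hm : 1 ≤ m) (hm' : m ≤ N.outdeg)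
    (hf : (N.faces ^ m) none = some f) :
    M.halfDegree (M.black (some e)) = m ∧ M.outdeg + m = N.outdeg + 1 := by
  have := h.finite
  obtain ⟨φ, he, hold, hM⟩ := h.exists_faces
  have hpow : ∀ k : ℕ, (φ ^ k) none = ((N.faces ^ k) none).map i := fun k => by
    have := apply_of_semiconj hold k none
    rwa [Option.map_none, zpow_natCast, zpow_natCast] at this
  have hfm : (φ ^ m) none = some (i f) := by rw [hpow, hf]; rfl
  have hn : {z | φ.SameCycle none z}.ncard = N.outdeg + 1 := by
    rw [← ncard_faces_none]
    exact ncard_cycle_of_semiconj (Option.map_injective h.inj) hold none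
  have hlt : m < Function.minimalPeriod φ none := by rw [← ncard_cycle, hn]; omega
  have hsame : φ.SameCycle none (some (i f)) := by
    rw [← hfm]; exact Perm.sameCycle_pow_right.2 .rfl
  set ψ := insertAfter φ none (some (i f)) with hψ
  have hψf : {z | ψ.SameCycle (some (i f)) z}.ncard = m := by
    have := ncard_cycle_insertAfter_pow hm hlt
    rwa [hfm] at this
  have hcut : ¬ ψ.SameCycle none (some (i f)) := not_sameCycle_insertAfter (by simp) hsame
  have hψn : {z | ψ.SameCycle none z}.ncard + m = N.outdeg + 1 := by
    have := ncard_cycle_insertAfter hcut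
    rw [hψ, insertAfter_insertAfter, ← hψ, hψf, hn] at this
    exact this.symm
  have hψe : ψ (some e) = some e := by
    rw [hψ, insertAfter_of_ne _ (by simp) (by simpa using (h.ne f).symm), he]
  have hen : ¬ ψ.SameCycle (some e) none := fun hs => by
    simpa using hs.eq_of_left hψe
  have hef : ¬ ψ.SameCycle (some e) (some (i f)) := fun hs => by
    have := hs.eq_of_left hψe
    exact h.ne f (by simpa using this.symm)
  have hMn : {z | M.faces.SameCycle none z}.ncard = 1 + {z | ψ.SameCycle none z}.ncard := by
    have h₁ := ncard_cycle_insertAfter hen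
    have h₂ : {z | ψ.SameCycle (some e) z}.ncard = 1 := by
      rw [ncard_cycle]; exact Function.minimalPeriod_eq_one_iff_isFixedPt.2 hψe
    rw [← hM, h₂] at h₁
    rw [← h₁]
    have h₃ : M.faces.SameCycle none (some e) := by
      rw [← h.black_none, ← faces_none]; exact Perm.sameCycle_apply_right.2 .rfl
    congr 1
    ext z
    exact ⟨fun hz => h₃.symm.trans hz, fun hz => h₃.trans hz⟩
  have hMf : ∀ z, M.faces.SameCycle (some (i f)) z ↔ ψ.SameCycle (some (i f)) z := fun z => by
    rw [hM, sameCycle_insertAfter hen]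
    constructor
    · rintro (hz | ⟨hz | hz, -⟩)
      · exact hz
      · exact absurd hz hef
      · exact absurd hz hcut
    · exact Or.inl
  constructor
  -- The corner at which the exploration reads off the label follows `f` along the face, hence lies
  -- on the arc that was cut off.
  · have h₁ : M.faces (some (i f)) = M.black (some e) := by rw [faces_some, h.white_f]
    have h₂ : ¬ M.faces.SameCycle (some (i f)) none := fun hs => hcut ((hMf none).1 hs).symm
    rw [← h₁, ← ncard_faces_some (by rwa [Perm.sameCycle_apply_left])]
    simp only [Perm.sameCycle_apply_left, hMf, hψf]
  · rw [ncard_faces_none] at hMn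
    omega

end IsAddEdge

theorem isAddEdge_closeFace {A : Type} {N : RotationSystem A} {m : ℕ} {f : A}
    (hf : (N.faces ^ m) none = some f) : IsAddEdge N (N.closeFace m) some none f := by
  have hold : ∀ x : Option A, (N.black.viaEmbedding (Function.Embedding.some).optionMap)
      (x.map some) = (N.black x).map some := fun x =>
    Perm.viaEmbedding_apply N.black (Function.Embedding.some (α := A)).optionMap x
  have hnew : (N.black.viaEmbedding (Function.Embedding.some).optionMap)
      (some none) = some none := by
    refine Perm.viaEmbedding_apply_of_notMem _ _ _ ?_
    rintro ⟨_ | x, hx⟩ <;> simp [Function.Embedding.optionMap] at hx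
  refine ⟨Option.some_injective A, by simp, fun x => ?_, ?_, ?_, fun a => ?_, ?_, ?_, fun a ha => ?_⟩
  · cases x <;> simp
  · rw [closeFace, insertAfter_right, hnew]
  · rw [closeFace, insertAfter_left, ← hold, Option.map_none]
  · rw [closeFace, insertAfter_of_ne _ (by simp) (by simp), ← hold, Option.map_some]
  · simp only [closeFace, hf]
    rw [insertAfter_right]; simp
  · simp only [closeFace, hf]
    rw [insertAfter_left]; simp
  · simp only [closeFace, hf]
    rw [insertAfter_of_ne _ (by simp) (by simpa using ha)]; simp

/-- The fields of the structure prescribe `M` entirely in terms of `N` and `f`, up to the names of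
the edges. -/
theorem IsAddEdge.exists_isIso {A E E' : Type} {N : RotationSystem A} {M : RotationSystem E}
    {M' : RotationSystem E'} {i : A → E} {i' : A → E'} {e : E} {e' : E'} {f : A}
    (h : IsAddEdge N M i e f) (h' : IsAddEdge N M' i' e' f) : ∃ F, M.IsIso M' F := by
  let F := (Equiv.ofBijective _ h.bijective).symm.trans (Equiv.ofBijective _ h'.bijective)
  have hFe : F e = e' := by
    have : e = Equiv.ofBijective _ h.bijective none := rfl
    simp only [F, Equiv.trans_apply]
    nth_rewrite 3 [this]
    rw [Equiv.symm_apply_apply]; rfl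
  have hFi : ∀ a, F (i a) = i' a := fun a => by
    have : i a = Equiv.ofBijective _ h.bijective (some a) := rfl
    simp only [F, Equiv.trans_apply]
    rw [this, Equiv.symm_apply_apply]; rfl
  have hFm : ∀ x : Option A, optionCongr F (x.map i) = x.map i' := by
    rintro (_ | a) <;> simp [hFi]
  refine ⟨F, fun x => ?_, fun x => ?_⟩
  · rcases h.cover_option x with rfl | ⟨_ | a, rfl⟩
    · rw [h.black_new, hFm, optionCongr_apply, Option.map_some, hFe, h'.black_new]
    · simp [h.black_none, h'.black_none, hFe]
    · rw [Option.map_some, h.black_old, hFm, optionCongr_apply, Option.map_some, hFi, h'.black_old]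
  · rcases h.cover x with rfl | ⟨a, rfl⟩
    · rw [h.white_new, hFe, hFi, h'.white_new]
    · rw [hFi]
      by_cases ha : a = f
      · subst ha; rw [h.white_f, h'.white_f, hFe]
      · rw [h.white_old a ha, h'.white_old a ha, hFi]

theorem IsAddEdge.of_isIso {A B E : Type} {N : RotationSystem A} {N' : RotationSystem B}
    {M : RotationSystem E} {i : A → E} {e : E} {f : A} (h : IsAddEdge N M i e f) {g : B ≃ A}
    (hg : N'.IsIso N g) : IsAddEdge N' M (i ∘ g) e (g.symm f) where
  inj := h.inj.comp g.injective
  ne a := h.ne _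
  cover x := by
    rcases h.cover x with rfl | ⟨a, rfl⟩
    · exact Or.inl rfl
    · exact Or.inr ⟨g.symm a, by simp⟩
  black_none := h.black_none
  black_new := by
    have := hg.1 none
    rw [optionCongr_apply, optionCongr_apply, Option.map_none] at this
    rw [h.black_new, this, Option.map_map]
  black_old a := by
    have := hg.1 (some a)
    rw [optionCongr_apply, optionCongr_apply, Option.map_some] at this
    rw [Function.comp_apply, h.black_old, this, Option.map_map]
  white_f := by simpa using h.white_f
  white_new := by rw [h.white_new, Function.comp_apply, ← hg.2, Equiv.apply_symm_apply]
  white_old a ha := by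
    rw [Function.comp_apply, h.white_old, hg.2, Function.comp_apply]
    rintro rfl; simp at ha

end RotationSystem

/-! ### Joining two maps by a bridge -/

namespace RotationSystem

/-- `M` arises from `L` and `R` by a new edge `e`, whose black half is clockwise next to the root
leg of `L` and whose white half comes just before the edge of `R` (if any) that precedes the root
leg of `R`; the latter is deleted. -/
structure IsJoin {A B E : Type} (L : RotationSystem A) (R : RotationSystem B)
    (M : RotationSystem E) (i : A → E) (j : B → E) (e : E) : Prop where
  inj_left : Function.Injective i
  inj_right : Function.Injective j
  disj : ∀ a b, i a ≠ j b
  ne_left : ∀ a, i a ≠ e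
  ne_right : ∀ b, j b ≠ e
  cover : ∀ x, x = e ∨ (∃ a, x = i a) ∨ ∃ b, x = j b
  black_none : M.black none = some e
  black_new : M.black (some e) = (L.black none).map i
  black_left : ∀ a, M.black (some (i a)) = (L.black (some a)).map i
  black_right : ∀ b, R.black (some b) ≠ none → M.black (some (j b)) = (R.black (some b)).map j
  black_right' : ∀ b, R.black (some b) = none → M.black (some (j b)) = (R.black none).map j
  white_left : ∀ a, M.white (i a) = i (L.white a)
  white_leaf : R.black none = none → M.white e = e
  white_new : ∀ b, R.black (some b) = none → M.white e = j b
  white_right : ∀ b, R.black (some (R.white b)) ≠ none → M.white (j b) = j (R.white b)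
  white_right' : ∀ b, R.black (some (R.white b)) = none → M.white (j b) = e

/-- Either the root leg is alone at its vertex, or some edge precedes it. -/
theorem black_none_cases {B : Type} (R : RotationSystem B) :
    (R.black none = none ∧ ∀ b, R.black (some b) ≠ none) ∨
      R.black none ≠ none ∧ ∃ b, R.black (some b) = none := by
  by_cases h : R.black none = none
  · refine Or.inl ⟨h, fun b hb => ?_⟩
    have := R.black.injective (h.trans hb.symm)
    simp at this
  · refine Or.inr ⟨h, ?_⟩
    obtain ⟨_ | b, hb⟩ := R.black.surjective none
    · exact absurd hb h
    · exact ⟨b, hb⟩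

namespace IsJoin

variable {A B E : Type} {L : RotationSystem A} {R : RotationSystem B} {M : RotationSystem E}
  {i : A → E} {j : B → E} {e : E}

theorem bijective (h : IsJoin L R M i j e) :
    Function.Bijective fun x : Option (A ⊕ B) => x.elim e (Sum.elim i j) := by
  refine ⟨?_, fun x => ?_⟩
  · rintro (_ | a | b) (_ | a' | b') hab
    · rfl
    · exact absurd hab.symm (h.ne_left a')
    · exact absurd hab.symm (h.ne_right b')
    · exact absurd hab (h.ne_left a)
    · exact congrArg _ (congrArg _ (h.inj_left hab))
    · exact absurd hab (h.disj a b')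
    · exact absurd hab (h.ne_right b)
    · exact absurd hab.symm (h.disj a' b)
    · exact congrArg _ (congrArg _ (h.inj_right hab))
  · rcases h.cover x with rfl | ⟨a, rfl⟩ | ⟨b, rfl⟩
    · exact ⟨none, rfl⟩
    · exact ⟨some (Sum.inl a), rfl⟩
    · exact ⟨some (Sum.inr b), rfl⟩

theorem finite [Finite A] [Finite B] (h : IsJoin L R M i j e) : Finite E :=
  Finite.of_surjective _ h.bijective.2

theorem card [Finite A] [Finite B] (h : IsJoin L R M i j e) :
    Nat.card E = Nat.card A + Nat.card B + 1 := by
  rw [← Nat.card_sum, ← Finite.card_option]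
  exact (Nat.card_congr (Equiv.ofBijective _ h.bijective)).symm

/-- All half-edges from `R` together with the white half of `e` form a set that only the edge `e`
leaves. -/
theorem isBridge (h : IsJoin L R M i j e) : M.IsBridge e := by
  intro hl
  have key := hl.iff (p := fun x =>
    (∃ b, x = Sum.inl (some (j b))) ∨ x = Sum.inr e ∨ ∃ b, x = Sum.inr (j b)) ?_ ?_ ?_
  · simp [(h.ne_right _).symm] at key
  · rintro (_ | x)
    · simp [h.black_none, fun b => (h.ne_right b).symm]
    · rcases h.cover x with rfl | ⟨a, rfl⟩ | ⟨b, rfl⟩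
      · simp only [h.black_new]
        cases L.black none <;> simp [h.disj, (h.ne_right _).symm]
      · simp only [h.black_left]
        cases L.black (some a) <;> simp [h.disj]
      · by_cases hb : R.black (some b) = none
        · rw [h.black_right' b hb]
          cases hb' : R.black none with
          | none => exact absurd (R.black.injective (hb.trans hb'.symm)) (by simp)
          | some b' => simp
        · rw [h.black_right b hb]
          cases hb' : R.black (some b) with
          | none => exact absurd hb' hb
          | some b' => simp
  · intro x
    rcases h.cover x with rfl | ⟨a, rfl⟩ | ⟨b, rfl⟩
    · rcases R.black_none_cases with ⟨h₁, -⟩ | ⟨-, b, hb⟩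
      · rw [h.white_leaf h₁]
      · simp [h.white_new b hb]
    · simp [h.white_left, h.disj, h.ne_left]
    · by_cases hb : R.black (some (R.white b)) = none
      · simp [h.white_right' b hb]
      · simp [h.white_right b hb]
  · intro x hx
    have : x ≠ e := hx
    simp [this]

theorem isEmbedding_left (h : IsJoin L R M i j e) : IsEmbedding L (M.delete e) i := by
  refine ⟨h.inj_left, ?_, fun a => ?_⟩
  · rintro (_ | a)
    · simp only [delete, Option.map_none]
      rw [detach_of_apply_eq _ h.black_none, h.black_new]
    · simp only [delete, Option.map_some]
      rw [detach_of_ne, h.black_left]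
      · simpa using h.ne_left a
      · rw [← h.black_none, M.black.injective.ne_iff]; simp
  · simp only [delete]
    rw [detach_of_ne _ (h.ne_left a), h.white_left a]
    rw [h.white_left]; exact h.ne_left _

theorem white_new_eq_iff (h : IsJoin L R M i j e) : M.white e = e ↔ R.black none = none := by
  rcases R.black_none_cases with ⟨h₁, -⟩ | ⟨h₁, b, hb⟩
  · simp [h.white_leaf h₁, h₁]
  · simp [h.white_new b hb, h₁, h.ne_right]

/-- The edge next to `e` around its white end is the one that precedes the root leg in `R`, so
moving the root leg just after it restores `R`. With a lone root leg there is no such edge, which is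
why that case is excluded. -/
theorem isEmbedding_right (h : IsJoin L R M i j e) (hR : R.black none ≠ none) :
    IsEmbedding R ((M.delete e).moveRoot (M.white e)) j := by
  obtain ⟨h₁, -⟩ | ⟨-, b₀, hb₀⟩ := R.black_none_cases
  · exact absurd h₁ hR
  have hD : ∀ b, (M.delete e).black (some (j b)) = M.black (some (j b)) := fun b => by
    refine detach_of_ne _ (by simpa using h.ne_right b) ?_
    rw [← h.black_none, M.black.injective.ne_iff]; simp
  have hD₂ : ∀ b, detach (M.delete e).black none (some (j b)) = M.black (some (j b)) := fun b => by
    rw [detach_of_ne _ (by simp) _, hD]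
    rw [hD]
    by_cases hb : R.black (some b) = none
    · rw [h.black_right' b hb]; simpa using hR
    · rw [h.black_right b hb]; simpa using hb
  rw [h.white_new b₀ hb₀]
  refine ⟨h.inj_right, ?_, fun b => ?_⟩
  · rintro (_ | b)
    · rw [Option.map_none, moveRoot, insertAfter_left, hD₂, h.black_right' b₀ hb₀]
    · rw [Option.map_some, moveRoot]
      by_cases hb : R.black (some b) = none
      · obtain rfl : b = b₀ := by simpa using R.black.injective (hb.trans hb₀.symm)
        rw [insertAfter_right, detach_self, hb, Option.map_none]
      · have hne : b ≠ b₀ := by rintro rfl; exact hb hb₀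
        rw [insertAfter_of_ne _ (by simp) (by simpa [h.inj_right.eq_iff] using hne), hD₂,
          h.black_right b hb]
  · simp only [moveRoot, delete]
    by_cases hb : R.black (some (R.white b)) = none
    · rw [detach_of_apply_eq _ (h.white_right' b hb), h.white_new _ hb]
    · rw [detach_of_ne _ (h.ne_right b), h.white_right b hb]
      rw [h.white_right b hb]; exact h.ne_right _

theorem connected (h : IsJoin L R M i j e) (hL : L.Connected) (hR : R.Connected) :
    M.Connected := by
  have h₀ : M.Linked Set.univ (Sum.inl none) (Sum.inl (some e)) := by
    simpa only [h.black_none] using linked_black M Set.univ none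
  rw [connected_iff_root]
  intro x
  rcases h.cover x with rfl | ⟨a, rfl⟩ | ⟨b, rfl⟩
  · exact h₀
  · refine (hL (Sum.inl none) (Sum.inl (some a))).map (Sum.map (Option.map i) i)
      ?_ (fun a => ?_) fun a _ => linked_edge M (Set.mem_univ _)
    · rintro (_ | a)
      · simp only [Sum.map_inl, ← h.black_new, Option.map_none]
        exact h₀.trans (linked_black M _ _)
      · simpa only [Sum.map_inl, ← h.black_left, Option.map_some] using linked_black M _ _
    · simpa only [Sum.map_inr, ← h.white_left] using linked_white M _ _
  -- The root leg of `R` no longer exists in `M`; the white half of `e` takes its place when chains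
  -- of links are transported.
  · refine (h₀.trans (linked_edge M (Set.mem_univ e))).trans ((hR (Sum.inl none)
      (Sum.inl (some b))).map (Sum.elim (fun x => x.elim (Sum.inr e) fun b => Sum.inl (some (j b)))
        fun b => Sum.inr (j b)) ?_ (fun b => ?_) fun b _ => linked_edge M (Set.mem_univ _))
    · have hw : ∀ b, R.black (some b) = none →
          M.Linked Set.univ (Sum.inr e) (Sum.inl (some (j b))) := fun b hb => by
        have := linked_white M Set.univ e
        rw [h.white_new b hb] at this
        exact this.trans (linked_edge M (Set.mem_univ _)).symm
      rintro (_ | b)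
      · rcases R.black_none_cases with ⟨h₁, -⟩ | ⟨h₁, b, hb⟩
        · rw [h₁]; exact .rfl
        · have h₂ := linked_black M Set.univ (some (j b))
          rw [h.black_right' b hb] at h₂
          obtain ⟨c, hc⟩ := Option.ne_none_iff_exists'.1 h₁
          rw [hc] at h₂ ⊢
          exact (hw b hb).trans h₂
      · by_cases hb : R.black (some b) = none
        · rw [hb]; exact (hw b hb).symm
        · have h₂ := linked_black M Set.univ (some (j b))
          rw [h.black_right b hb] at h₂
          obtain ⟨c, hc⟩ := Option.ne_none_iff_exists'.1 hb
          rw [hc] at h₂ ⊢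
          exact h₂
    · have h₂ := linked_white M Set.univ (j b)
      by_cases hb : R.black (some (R.white b)) = none
      · rw [h.white_right' b hb] at h₂
        have h₃ := linked_white M Set.univ e
        rw [h.white_new _ hb] at h₃
        exact h₂.trans h₃
      · rwa [h.white_right b hb] at h₂

/-- The root leg of `R` plays the role of the new edge. -/
theorem bijective_option (h : IsJoin L R M i j e) :
    Function.Bijective (Sum.elim (Option.map i) fun x : Option B => some (x.elim e j)) := by
  constructor
  · refine (Option.map_injective h.inj_left).sumElim ?_ ?_
    · rintro (_ | b) (_ | b') hab
      · rfl
      · exact absurd (by simpa using hab.symm) (h.ne_right b')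
      · exact absurd (by simpa using hab) (h.ne_right b)
      · exact congrArg some (h.inj_right (by simpa using hab))
    · rintro (_ | a) (_ | b) <;> simp [h.ne_left, h.disj]
  · rintro (_ | x)
    · exact ⟨Sum.inl none, rfl⟩
    · rcases h.cover x with rfl | ⟨a, rfl⟩ | ⟨b, rfl⟩
      · exact ⟨Sum.inr none, rfl⟩
      · exact ⟨Sum.inl (some a), rfl⟩
      · exact ⟨Sum.inr (some b), rfl⟩

/-- The faces of a join: the root face of `L` is merged with that of `R`. -/
theorem exists_faces (h : IsJoin L R M i j e) :
    ∃ (φ : Perm (Option E)) (z : Option B), R.faces z = none ∧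
      (∀ x : Option A, φ (x.map i) = (L.faces x).map i) ∧
      (∀ x : Option B, φ (some (x.elim e j)) = some ((R.faces x).elim e j)) ∧
      M.faces = insertAfter φ none (some (z.elim e j)) := by
  -- `z` is the last element before the root leg on the outer face of `R`; when `R` has a lone root
  -- leg, `z` is that leg and becomes `e`.
  obtain ⟨z, hz⟩ := R.faces.surjective none
  have hMz : M.faces (some (z.elim e j)) = (L.black none).map i := by
    rcases z with _ | b
    · rw [faces_none] at hz
      simp [h.white_leaf hz, h.black_new]
    · rw [faces_some] at hz
      simp [h.white_right' b hz, h.black_new]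
  refine ⟨insertAfter M.faces none (some (z.elim e j)), z, hz, ?_, fun x => ?_,
    (insertAfter_insertAfter _ _ _).symm⟩
  · rintro (_ | a)
    · rw [Option.map_none, insertAfter_left, hMz, faces_none]
    · rw [Option.map_some, insertAfter_of_ne _ (by simp), faces_some, faces_some, h.white_left,
        h.black_left]
      cases z <;> simp [h.ne_left, h.disj]
  · by_cases hx : x = z
    · subst hx
      rw [insertAfter_right, hz, faces_none, h.black_none]; rfl
    · have hne : R.faces x ≠ none := by
        rw [← hz]; exact R.faces.injective.ne hx
      rw [insertAfter_of_ne _ (by simp)]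
      · rcases x with _ | b
        · rw [faces_none] at hne ⊢
          obtain ⟨h₁, -⟩ | ⟨-, b₀, hb₀⟩ := R.black_none_cases
          · exact absurd h₁ hne
          · rw [Option.elim_none, faces_some, h.white_new b₀ hb₀, h.black_right' b₀ hb₀]
            obtain ⟨c, hc⟩ := Option.ne_none_iff_exists'.1 hne
            rw [hc]; rfl
        · rw [faces_some] at hne ⊢
          rw [Option.elim_some, faces_some, h.white_right b hne, h.black_right _ hne]
          obtain ⟨c, hc⟩ := Option.ne_none_iff_exists'.1 hne
          rw [hc]; rfl
      · intro he
        have := h.bijective_option.1 (a₁ := Sum.inr x) (a₂ := Sum.inr z) he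
        exact hx (by simpa using this)

section Counts

variable [Finite A] [Finite B]

theorem numFaces (h : IsJoin L R M i j e) : M.numFaces + 1 = L.numFaces + R.numFaces := by
  have := h.finite
  obtain ⟨φ, z, hz, hL, hR, hM⟩ := h.exists_faces
  have h₁ : numCycles φ = L.numFaces + R.numFaces := numCycles_sum h.bijective_option hL hR
  rw [← h₁, RotationSystem.numFaces, hM]
  refine numCycles_insertAfter fun hs => ?_
  obtain ⟨x, hx⟩ := SameCycle.exists_of_semiconj hL (x := none) hs
  cases x <;> cases z <;> simp [h.disj, (h.ne_left _).symm, eq_comm] at hx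

theorem outdeg (h : IsJoin L R M i j e) : M.outdeg = L.outdeg + R.outdeg + 1 := by
  have := h.finite
  obtain ⟨φ, z, hz, hL, hR, hM⟩ := h.exists_faces
  have hs : ¬ φ.SameCycle none (some (z.elim e j)) := fun hs => by
    obtain ⟨x, hx⟩ := SameCycle.exists_of_semiconj hL (x := none) hs
    cases x <;> cases z <;> simp [h.disj, (h.ne_left _).symm, eq_comm] at hx
  have h₁ := ncard_cycle_insertAfter hs
  rw [← hM, ncard_faces_none] at h₁
  have h₂ := ncard_cycle_of_semiconj (Option.map_injective h.inj_left) hL none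
  rw [ncard_faces_none] at h₂
  have hinj : Function.Injective fun x : Option B => some (x.elim e j) := fun x y hxy => by
    simpa using h.bijective_option.1 (a₁ := Sum.inr x) (a₂ := Sum.inr y) hxy
  have h₃ := ncard_cycle_of_semiconj hinj hR z
  have h₄ : {y | R.faces.SameCycle z y} = {y | R.faces.SameCycle none y} := by
    ext y
    rw [Set.mem_ofPred_eq, ← Perm.sameCycle_apply_left, hz]; rfl
  rw [h₄, ncard_faces_none] at h₃
  simp only [Option.map_none] at h₂
  omega

-- A lone root leg in `R` makes `e` a fixed point, that is, a new white vertex; otherwise `e` enters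
-- an existing white cycle of `R`.
open Classical in
theorem numWhite (h : IsJoin L R M i j e) :
    M.numWhite = L.numWhite + R.numWhite + if R.black none = none then 1 else 0 := by
  have := h.finite
  have hinj : Function.Injective (Sum.elim i j) := h.inj_left.sumElim h.inj_right h.disj
  have hcov : ∀ x, x = e ∨ ∃ y, x = Sum.elim i j y := fun x => by
    rcases h.cover x with rfl | ⟨a, rfl⟩ | ⟨b, rfl⟩
    · exact Or.inl rfl
    · exact Or.inr ⟨Sum.inl a, rfl⟩
    · exact Or.inr ⟨Sum.inr b, rfl⟩
  have hne : ∀ y, Sum.elim i j y ≠ e := by rintro (a | b) <;> simp [h.ne_left, h.ne_right]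
  have hsum : numCycles (Perm.sumCongr L.white R.white) = L.numWhite + R.numWhite :=
    numCycles_sum (i := Sum.inl) (j := Sum.inr) (by
      rw [Sum.elim_inl_inr]; exact Function.bijective_id) (fun x => rfl) (fun x => rfl)
  rcases R.black_none_cases with ⟨h₁, h₂⟩ | ⟨h₁, b₀, hb₀⟩
  · rw [if_pos h₁, ← hsum]
    refine numCycles_add_fixedPoint hinj hcov hne ?_ (h.white_leaf h₁)
    rintro (a | b)
    · exact h.white_left a
    · exact h.white_right b (h₂ _)
  · rw [if_neg h₁, ← hsum, Nat.add_zero]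
    obtain ⟨c, rfl⟩ := R.white.surjective b₀
    set ω := insertAfter M.white e (j c) with hω
    have he : ω e = e := by rw [hω, insertAfter_left, h.white_right' c hb₀]
    have hcount : numCycles ω = numCycles (Perm.sumCongr L.white R.white) + 1 := by
      refine numCycles_add_fixedPoint hinj hcov hne ?_ he
      rintro (a | b)
      · rw [Sum.elim_inl, hω, insertAfter_of_ne _ (h.ne_left a) (h.disj a c), h.white_left]; rfl
      · by_cases hb : b = c
        · subst hb
          rw [Sum.elim_inr, hω, insertAfter_right, h.white_new _ hb₀]; rfl
        · rw [Sum.elim_inr, hω, insertAfter_of_ne _ (h.ne_right b) (h.inj_right.ne hb),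
            h.white_right]
          · rfl
          · intro hb'
            exact hb (by simpa using R.black.injective (hb'.trans hb₀.symm))
    have h₃ : ¬ ω.SameCycle e (j c) := fun hs => h.ne_right c (hs.eq_of_left he).symm
    have h₄ := numCycles_insertAfter h₃
    rw [show insertAfter ω e (j c) = M.white from insertAfter_insertAfter _ _ _] at h₄
    change M.numWhite + 1 = _ at h₄
    omega

-- Only a lone root leg of `R` is a black vertex that disappears in `M`; any other vertex of `R`
-- that carries the root leg survives its removal.
open Classical in
theorem numBlack (h : IsJoin L R M i j e) :
    (M.numBlack + if R.black none = none then 1 else 0) = L.numBlack + R.numBlack := by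
  have := h.finite
  set β := insertAfter M.black (some e) none with hβ
  have he : β (some e) = some e := by rw [hβ, insertAfter_left, h.black_none]
  have hleft : ∀ x : Option A, β (x.map i) = (L.black x).map i := by
    rintro (_ | a)
    · rw [Option.map_none, hβ, insertAfter_right, h.black_new]
    · rw [Option.map_some, hβ, insertAfter_of_ne _ (by simpa using h.ne_left a) (by simp),
        h.black_left]
  have hright : ∀ b, β (some (j b)) = M.black (some (j b)) := fun b =>
    insertAfter_of_ne _ (by simpa using h.ne_right b) (by simp)
  have hβM : M.numBlack + 1 = numCycles β := by
    have h₂ : ¬ β.SameCycle (some e) none := fun hs => by simpa using hs.eq_of_left he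
    have h₃ := numCycles_insertAfter h₂
    rwa [show insertAfter β (some e) none = M.black from insertAfter_insertAfter _ _ _] at h₃
  rcases R.black_none_cases with ⟨h₁, h₂⟩ | ⟨h₁, b₀, hb₀⟩
  · rw [if_pos h₁, hβM]
    refine numCycles_sum h.bijective_option hleft ?_
    rintro (_ | b)
    · rw [h₁, Option.elim_none, he]
    · rw [Option.elim_some, hright, h.black_right b (h₂ b)]
      obtain ⟨c, hc⟩ := Option.ne_none_iff_exists'.1 (h₂ b)
      rw [hc]; rfl
  · rw [if_neg h₁, Nat.add_zero]
    -- Inserting `e` after `j b₀` restores the root leg of `R` under the name `e`.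
    set γ := insertAfter β (some e) (some (j b₀)) with hγ
    have hcount : numCycles γ = L.numBlack + R.numBlack := by
      refine numCycles_sum h.bijective_option ?_ ?_
      · intro x
        rw [hγ, insertAfter_of_ne, hleft]
        · cases x <;> simp [h.ne_left]
        · cases x <;> simp [h.disj]
      · rintro (_ | b)
        · rw [Option.elim_none, hγ, insertAfter_left, hright, h.black_right' b₀ hb₀]
          obtain ⟨c, hc⟩ := Option.ne_none_iff_exists'.1 h₁
          rw [hc]; rfl
        · rw [Option.elim_some, hγ]
          by_cases hb : b = b₀
          · subst hb
            rw [insertAfter_right, he, hb₀]; rfl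
          · have hb' : R.black (some b) ≠ none := fun hb' =>
              hb (by simpa using R.black.injective (hb'.trans hb₀.symm))
            rw [insertAfter_of_ne _ (by simpa using h.ne_right b)
              (by simpa [h.inj_right.eq_iff] using hb), hright, h.black_right b hb']
            obtain ⟨c, hc⟩ := Option.ne_none_iff_exists'.1 hb'
            rw [hc]; rfl
    have h₂ : ¬ β.SameCycle (some e) (some (j b₀)) := fun hs =>
      h.ne_right b₀ (by simpa using (hs.eq_of_left he).symm)
    have h₃ := numCycles_insertAfter h₂
    rw [← hγ] at h₃
    omega

end Counts

theorem exists_isIso {E' : Type} {M' : RotationSystem E'} {i' : A → E'} {j' : B → E'} {e' : E'}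
    (h : IsJoin L R M i j e) (h' : IsJoin L R M' i' j' e') : ∃ F, M.IsIso M' F := by
  let F := (Equiv.ofBijective _ h.bijective).symm.trans (Equiv.ofBijective _ h'.bijective)
  have hF : ∀ x : Option (A ⊕ B), F (x.elim e (Sum.elim i j)) = x.elim e' (Sum.elim i' j') :=
    fun x => by
      have : x.elim e (Sum.elim i j) = Equiv.ofBijective _ h.bijective x := rfl
      simp only [F, Equiv.trans_apply]
      rw [this, Equiv.symm_apply_apply]; rfl
  have hFe : F e = e' := hF none
  have hFi : ∀ a, F (i a) = i' a := fun a => hF (some (Sum.inl a))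
  have hFj : ∀ b, F (j b) = j' b := fun b => hF (some (Sum.inr b))
  have hFmi : ∀ x : Option A, optionCongr F (x.map i) = x.map i' := by
    rintro (_ | a) <;> simp [hFi]
  have hFmj : ∀ x : Option B, optionCongr F (x.map j) = x.map j' := by
    rintro (_ | a) <;> simp [hFj]
  refine ⟨F, ?_, fun x => ?_⟩
  · rintro (_ | x)
    · simp [h.black_none, h'.black_none, hFe]
    · rw [optionCongr_apply, Option.map_some]
      rcases h.cover x with rfl | ⟨a, rfl⟩ | ⟨b, rfl⟩
      · rw [hFe, h.black_new, h'.black_new, hFmi]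
      · rw [hFi, h.black_left, h'.black_left, hFmi]
      · rw [hFj]
        by_cases hb : R.black (some b) = none
        · rw [h.black_right' b hb, h'.black_right' b hb, hFmj]
        · rw [h.black_right b hb, h'.black_right b hb, hFmj]
  · rcases h.cover x with rfl | ⟨a, rfl⟩ | ⟨b, rfl⟩
    · rw [hFe]
      rcases R.black_none_cases with ⟨h₁, -⟩ | ⟨-, b, hb⟩
      · rw [h.white_leaf h₁, h'.white_leaf h₁, hFe]
      · rw [h.white_new b hb, h'.white_new b hb, hFj]
    · rw [hFi, h.white_left, h'.white_left, hFi]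
    · rw [hFj]
      by_cases hb : R.black (some (R.white b)) = none
      · rw [h.white_right' b hb, h'.white_right' b hb, hFe]
      · rw [h.white_right b hb, h'.white_right b hb, hFj]

theorem of_isIso {A' B' : Type} {L' : RotationSystem A'} {R' : RotationSystem B'}
    (h : IsJoin L R M i j e) {f : A' ≃ A} {g : B' ≃ B} (hf : L'.IsIso L f) (hg : R'.IsIso R g) :
    IsJoin L' R' M (i ∘ f) (j ∘ g) e := by
  have hf₀ : L.black none = (L'.black none).map f := hf.1 none
  have hf₁ : ∀ a, L.black (some (f a)) = (L'.black (some a)).map f := fun a => hf.1 (some a)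
  have hg₀ : R.black none = (R'.black none).map g := hg.1 none
  have hg₁ : ∀ b, R.black (some (g b)) = (R'.black (some b)).map g := fun b => hg.1 (some b)
  have hg₂ : ∀ b, R.black (some (g b)) = none ↔ R'.black (some b) = none := fun b => by
    rw [hg₁]; simp
  have hg₃ : ∀ b, R.black (some (R.white (g b))) = none ↔ R'.black (some (R'.white b)) = none :=
    fun b => by rw [hg.2, hg₂]
  exact
  { inj_left := h.inj_left.comp f.injective
    inj_right := h.inj_right.comp g.injective
    disj := fun _ _ => h.disj _ _
    ne_left := fun _ => h.ne_left _
    ne_right := fun _ => h.ne_right _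
    cover := fun x => by
      rcases h.cover x with rfl | ⟨a, rfl⟩ | ⟨b, rfl⟩
      · exact Or.inl rfl
      · exact Or.inr (Or.inl ⟨f.symm a, by simp⟩)
      · exact Or.inr (Or.inr ⟨g.symm b, by simp⟩)
    black_none := h.black_none
    black_new := by rw [h.black_new, hf₀, Option.map_map]
    black_left := fun a => by rw [Function.comp_apply, h.black_left, hf₁, Option.map_map]
    black_right := fun b hb => by
      rw [Function.comp_apply, h.black_right _ (mt (hg₂ b).1 hb), hg₁, Option.map_map]
    black_right' := fun b hb => by
      rw [Function.comp_apply, h.black_right' _ ((hg₂ b).2 hb), hg₀, Option.map_map]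
    white_left := fun a => by
      rw [Function.comp_apply, h.white_left, hf.2, Function.comp_apply]
    white_leaf := fun hb => h.white_leaf (by rw [hg₀, hb, Option.map_none])
    white_new := fun b hb => h.white_new _ ((hg₂ b).2 hb)
    white_right := fun b hb => by
      rw [Function.comp_apply, h.white_right _ (mt (hg₃ b).1 hb), hg.2, Function.comp_apply]
    white_right' := fun b hb => h.white_right' _ ((hg₃ b).2 hb) }

end IsJoin

theorem isJoin_join {A B : Type} (L : RotationSystem A) (R : RotationSystem B) :
    IsJoin L R (L.join R) (fun a => some (Sum.inl a)) (fun b => some (Sum.inr b)) none := by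
  set β := L.black.viaEmbedding (Function.Embedding.inl.trans .some : A ↪ Option (A ⊕ B)).optionMap
    with hβ
  set γ := Perm.viaEmbedding (removeNone R.black)
    ((Function.Embedding.inr.trans .some).trans .some : B ↪ Option (Option (A ⊕ B))) with hγ
  have hβ₁ : ∀ x : Option A, β (x.map fun a => some (Sum.inl a)) =
      (L.black x).map fun a => some (Sum.inl a) := fun x =>
    Perm.viaEmbedding_apply L.black
      (Function.Embedding.inl.trans .some : A ↪ Option (A ⊕ B)).optionMap x
  have hβ₂ : ∀ z : Option (Option (A ⊕ B)), (∀ x : Option A, z ≠ x.map fun a => some (Sum.inl a)) →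
      β z = z := fun z hz => by
    refine Perm.viaEmbedding_apply_of_notMem _ _ _ ?_
    rintro ⟨x, hx⟩
    exact hz x hx.symm
  have hγ₁ : ∀ b, γ (some (some (Sum.inr b))) = some (some (Sum.inr (removeNone R.black b))) :=
    fun b => Perm.viaEmbedding_apply (removeNone R.black)
      ((Function.Embedding.inr.trans .some).trans .some : B ↪ Option (Option (A ⊕ B))) b
  have hγ₂ : ∀ z : Option (Option (A ⊕ B)), (∀ b, z ≠ some (some (Sum.inr b))) → γ z = z :=
    fun z hz => by
      refine Perm.viaEmbedding_apply_of_notMem _ _ _ ?_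
      rintro ⟨x, hx⟩
      exact hz x hx.symm
  have hb : (L.join R).black = insertAfter (β * γ) (some none) none := rfl
  have hleft : ∀ x : Option A, (β * γ) (x.map fun a => some (Sum.inl a)) =
      (L.black x).map fun a => some (Sum.inl a) := fun x => by
    rw [Perm.mul_apply, hγ₂, hβ₁]
    cases x <;> simp
  have hright : ∀ b, (L.join R).black (some (some (Sum.inr b))) =
      some (some (Sum.inr (removeNone R.black b))) := fun b => by
    rw [hb, insertAfter_of_ne _ (by simp) (by simp), Perm.mul_apply, hγ₁, hβ₂]
    rintro (_ | a) <;> simp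
  have hw : ∀ b, R.black (some b) = none ↔ R.black.symm none = some b := fun b => by
    rw [Equiv.symm_apply_eq, eq_comm]
  have hw₀ : R.black none = none ↔ R.black.symm none = none := by
    rw [Equiv.symm_apply_eq, eq_comm]
  refine ⟨fun a b => by simp, fun a b => by simp, by simp, by simp, by simp, ?_, ?_, ?_,
    fun a => ?_, fun b hb' => ?_, fun b hb' => ?_, fun a => ?_, fun h => ?_, fun b h => ?_,
    fun b h => ?_, fun b h => ?_⟩
  · rintro (_ | a | b) <;> simp
  · rw [hb, insertAfter_right, Perm.mul_apply, hγ₂ _ (by simp), hβ₂]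
    rintro (_ | a) <;> simp
  · rw [hb, insertAfter_left]; exact hleft none
  · rw [hb, insertAfter_of_ne _ (by simp) (by simp)]; exact hleft (some a)
  · rw [hright]
    obtain ⟨c, hc⟩ := Option.ne_none_iff_exists'.1 hb'
    have := removeNone_some R.black ⟨c, hc⟩
    rw [← this]; rfl
  · rw [hright, ← removeNone_none R.black hb']; rfl
  · simp only [join]
    split
    · rfl
    · simp [insertBefore, swap_apply_def]
  · rw [hw₀] at h
    simp only [join, h]; rfl
  · rw [hw] at h
    simp only [join, h]
    rw [insertBefore, Perm.mul_apply]; simp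
  · rw [Ne, hw] at h
    simp only [join]
    split
    · rfl
    · next e' he' =>
      have : R.white b ≠ e' := by rintro rfl; exact h he'
      simp [insertBefore, swap_apply_def, this]
  · rw [hw] at h
    simp only [join, h]
    rw [insertBefore, Perm.mul_apply]; simp

end RotationSystem

/-! ### Decomposing a connected map at its root edge -/

theorem exists_perm_of_semiconj {α β : Type*} [Finite α] {i : α → β} (hi : Function.Injective i)
    {π : Perm β} (h : ∀ x, ∃ y, π (i x) = i y) : ∃ σ : Perm α, ∀ x, π (i x) = i (σ x) := by
  choose s hs using h
  have hinj : Function.Injective s := fun x y hxy => by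
    apply hi; apply π.injective; rw [hs, hs, hxy]
  exact ⟨Equiv.ofBijective s (Finite.injective_iff_bijective.1 hinj), hs⟩

namespace RotationSystem

/-- Links of `M` that avoid `e` project to `N` when the black half of `e` is collapsed onto the root
leg and its white half onto that of `f`. -/
theorem IsAddEdge.connected_of_not_isBridge {A E : Type} {N : RotationSystem A}
    {M : RotationSystem E} {i : A → E} {e : E} {f : A} (h : IsAddEdge N M i e f)
    (hM : M.Connected) (he : ¬ M.IsBridge e) : N.Connected := by
  rw [IsBridge, not_not] at he
  have hM' : ∀ x y, M.Linked {g | g ≠ e} x y := fun x y =>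
    (hM x y).map id (fun x => linked_black M _ x) (fun x => linked_white M _ x) fun x _ => by
      by_cases hx : x = e
      · subst hx; exact he
      · exact linked_edge M hx
  let F := (Equiv.ofBijective _ h.bijective).symm
  have hFe : F e = none := (Equiv.ofBijective _ h.bijective).symm_apply_apply none
  have hFi : ∀ a, F (i a) = some a := fun a =>
    (Equiv.ofBijective _ h.bijective).symm_apply_apply (some a)
  let g : Option E ⊕ E → Option A ⊕ A :=
    Sum.elim (fun x => Sum.inl (x.bind F)) fun x => Sum.inr ((F x).getD f)
  have hg : ∀ x : Option A, g (Sum.inl (x.map i)) = Sum.inl x := by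
    rintro (_ | a) <;> simp [g, hFi]
  have hge : g (Sum.inl (some e)) = Sum.inl none := by simp [g, hFe]
  have hgi : ∀ a, g (Sum.inr (i a)) = Sum.inr a := fun a => by simp [g, hFi]
  have hge' : g (Sum.inr e) = Sum.inr f := by simp [g, hFe]
  rw [connected_iff_root]
  intro a
  have key := (hM' (Sum.inl none) (Sum.inl (some (i a)))).map (N := N) (T := Set.univ) g
    ?_ (fun x => ?_) fun x hx => ?_
  · have h₀ := hg none
    have h₁ := hg (some a)
    rw [Option.map_none] at h₀
    rw [Option.map_some] at h₁
    rwa [h₀, h₁] at key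
  · rintro x
    rcases h.cover_option x with rfl | ⟨_ | a, rfl⟩
    · rw [h.black_new, hg, hge]; exact linked_black N _ _
    · rw [hg, Option.map_none, h.black_none, hge]; exact .rfl
    · rw [hg, Option.map_some, h.black_old, hg]; exact linked_black N _ _
  · rcases h.cover x with rfl | ⟨a, rfl⟩
    · rw [h.white_new, hge', hgi]; exact linked_white N _ _
    · by_cases ha : a = f
      · subst ha; rw [h.white_f, hge', hgi]; exact .rfl
      · rw [h.white_old a ha, hgi, hgi]; exact linked_white N _ _
  · rcases h.cover x with rfl | ⟨a, rfl⟩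
    · exact absurd rfl hx
    · have h₁ := hg (some a)
      rw [Option.map_some] at h₁
      rw [h₁, hgi]; exact linked_edge N (Set.mem_univ a)

/-- `N` lives on the edges other than `e`, with `e` taken out of both of its cycles, and `f` is the
edge before `e` around the white end. -/
theorem exists_isAddEdge {E : Type} [Finite E] {M : RotationSystem E} (hM : M.Connected) {e : E}
    (h0 : M.black none = some e) (he : ¬ M.IsBridge e) :
    ∃ (A : Type) (N : RotationSystem A) (i : A → E) (f : A),
      Finite A ∧ N.Connected ∧ IsAddEdge N M i e f := by
  obtain ⟨f, hf⟩ := M.white.surjective e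
  -- Otherwise the white end of `e` has degree one, and `e` is a bridge.
  have hfe : f ≠ e := by
    rintro rfl
    refine he fun hl => ?_
    have key := hl.iff (p := fun z => z = Sum.inr f) (by simp) (fun x => ?_) fun x hx => ?_
    · simp at key
    · rw [Sum.inr.injEq, Sum.inr.injEq]
      refine ⟨fun hx => by rw [hx, hf], fun hx => M.white.injective (hx.trans hf.symm)⟩
    · have : x ≠ f := hx
      simp [this]
  let i : {x // x ≠ e} → E := Subtype.val
  have hi : Function.Injective i := Subtype.val_injective
  have hcov : ∀ x, x ≠ e → ∃ a, x = i a := fun x hx => ⟨⟨x, hx⟩, rfl⟩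
  have hne : ∀ a, i a ≠ e := fun a => a.2
  have hcov' : ∀ x : Option E, x ≠ some e → ∃ a : Option {x // x ≠ e}, x = a.map i := by
    rintro (_ | x) hx
    · exact ⟨none, rfl⟩
    · obtain ⟨a, rfl⟩ := hcov x (by simpa using hx)
      exact ⟨some a, rfl⟩
  set β := insertAfter M.black (some e) none with hβ
  have hβe : β (some e) = some e := by rw [hβ, insertAfter_left, h0]
  set ω := insertAfter M.white e f with hω
  have hωe : ω e = e := by rw [hω, insertAfter_left, hf]
  obtain ⟨b, hb⟩ := exists_perm_of_semiconj (Option.map_injective hi) (π := β) fun x => by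
    refine hcov' _ fun hx => ?_
    have := β.injective (hx.trans hβe.symm)
    cases x <;> simp [hne] at this
  obtain ⟨w, hw⟩ := exists_perm_of_semiconj hi (π := ω) fun x => by
    exact hcov _ fun hx => hne x (ω.injective (hx.trans hωe.symm))
  have key : IsAddEdge ⟨b, w⟩ M i e ⟨f, hfe⟩ := by
    refine ⟨hi, hne, fun x => ?_, h0, ?_, fun a => ?_, hf, ?_, fun a ha => ?_⟩
    · exact or_iff_not_imp_left.2 (hcov x)
    · rw [← hb, Option.map_none, hβ, insertAfter_right]
    · rw [← hb, Option.map_some, hβ, insertAfter_of_ne _ (by simpa using hne a) (by simp)]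
    · rw [← hw, hω, insertAfter_right]
    · rw [← hw, hω, insertAfter_of_ne _ (hne a)]
      exact fun h => ha (Subtype.ext h)
  exact ⟨_, _, i, _, inferInstance, key.connected_of_not_isBridge hM he, key⟩

namespace IsJoin

variable {A B E : Type} {L : RotationSystem A} {R : RotationSystem B} {M : RotationSystem E}
  {i : A → E} {j : B → E} {e : E}

/-- Collapse `e` and everything from `R` onto the root leg of `L`: every link of `M` becomes a link
of `L` or trivial. -/
theorem connected_left (h : IsJoin L R M i j e) (hM : M.Connected) : L.Connected := by
  let F := (Equiv.ofBijective _ h.bijective).symm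
  have hFe : F e = none := (Equiv.ofBijective _ h.bijective).symm_apply_apply none
  have hFi : ∀ a, F (i a) = some (Sum.inl a) := fun a =>
    (Equiv.ofBijective _ h.bijective).symm_apply_apply (some (Sum.inl a))
  have hFj : ∀ b, F (j b) = some (Sum.inr b) := fun b =>
    (Equiv.ofBijective _ h.bijective).symm_apply_apply (some (Sum.inr b))
  let g : Option E ⊕ E → Option A ⊕ A := Sum.elim
    (fun x => Sum.inl ((x.bind F).bind Sum.getLeft?))
    fun x => ((F x).bind Sum.getLeft?).elim (Sum.inl none) Sum.inr
  have hg : ∀ x : Option A, g (Sum.inl (x.map i)) = Sum.inl x := by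
    rintro (_ | a) <;> simp [g, hFi]
  have hge : g (Sum.inl (some e)) = Sum.inl none := by simp [g, hFe]
  have hgj : ∀ x : Option B, g (Sum.inl (x.map j)) = Sum.inl none := by
    rintro (_ | a) <;> simp [g, hFj]
  have hgi : ∀ a, g (Sum.inr (i a)) = Sum.inr a := fun a => by simp [g, hFi]
  have hgj' : ∀ b, g (Sum.inr (j b)) = Sum.inl none := fun b => by simp [g, hFj]
  have hge' : g (Sum.inr e) = Sum.inl none := by simp [g, hFe]
  have hg₀ : g (Sum.inl none) = Sum.inl none := hg none
  have hgi₁ : ∀ a, g (Sum.inl (some (i a))) = Sum.inl (some a) := fun a => hg (some a)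
  have hgj₁ : ∀ b, g (Sum.inl (some (j b))) = Sum.inl none := fun b => hgj (some b)
  rw [connected_iff_root]
  intro a
  have key := (hM (Sum.inl none) (Sum.inl (some (i a)))).map (N := L) (T := Set.univ) g
    ?_ (fun x => ?_) fun x hx => ?_
  · rwa [hg₀, hgi₁] at key
  · rintro (_ | x)
    · rw [hg₀, h.black_none, hge]; exact .rfl
    · rcases h.cover x with rfl | ⟨a, rfl⟩ | ⟨b, rfl⟩
      · rw [h.black_new, hg, hge]; exact linked_black L _ _
      · rw [h.black_left, hg, hgi₁]; exact linked_black L _ _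
      · by_cases hb : R.black (some b) = none
        · rw [h.black_right' b hb, hgj, hgj₁]; exact .rfl
        · rw [h.black_right b hb, hgj, hgj₁]; exact .rfl
  · rcases h.cover x with rfl | ⟨a, rfl⟩ | ⟨b, rfl⟩
    · rcases R.black_none_cases with ⟨h₁, -⟩ | ⟨-, b, hb⟩
      · rw [h.white_leaf h₁]; exact .rfl
      · rw [h.white_new b hb, hge', hgj']; exact .rfl
    · rw [h.white_left, hgi, hgi]; exact linked_white L _ _
    · by_cases hb : R.black (some (R.white b)) = none
      · rw [h.white_right' b hb, hgj', hge']; exact .rfl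
      · rw [h.white_right b hb, hgj', hgj']; exact .rfl
  · rcases h.cover x with rfl | ⟨a, rfl⟩ | ⟨b, rfl⟩
    · rw [hge, hge']; exact .rfl
    · rw [hgi₁, hgi]; exact linked_edge L (Set.mem_univ a)
    · rw [hgj₁, hgj']; exact .rfl

/-- Here `e` and everything from `L` collapse onto the root leg of `R`. Where `R` had its root leg,
a step in `M` may correspond to two steps in `R`. -/
theorem connected_right (h : IsJoin L R M i j e) (hM : M.Connected) : R.Connected := by
  let F := (Equiv.ofBijective _ h.bijective).symm
  have hFe : F e = none := (Equiv.ofBijective _ h.bijective).symm_apply_apply none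
  have hFi : ∀ a, F (i a) = some (Sum.inl a) := fun a =>
    (Equiv.ofBijective _ h.bijective).symm_apply_apply (some (Sum.inl a))
  have hFj : ∀ b, F (j b) = some (Sum.inr b) := fun b =>
    (Equiv.ofBijective _ h.bijective).symm_apply_apply (some (Sum.inr b))
  let g : Option E ⊕ E → Option B ⊕ B := Sum.elim
    (fun x => Sum.inl ((x.bind F).bind Sum.getRight?))
    fun x => ((F x).bind Sum.getRight?).elim (Sum.inl none) Sum.inr
  have hg : ∀ x : Option B, g (Sum.inl (x.map j)) = Sum.inl x := by
    rintro (_ | a) <;> simp [g, hFj]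
  have hge : g (Sum.inl (some e)) = Sum.inl none := by simp [g, hFe]
  have hgi : ∀ x : Option A, g (Sum.inl (x.map i)) = Sum.inl none := by
    rintro (_ | a) <;> simp [g, hFi]
  have hgj' : ∀ b, g (Sum.inr (j b)) = Sum.inr b := fun a => by simp [g, hFj]
  have hgi' : ∀ a, g (Sum.inr (i a)) = Sum.inl none := fun b => by simp [g, hFi]
  have hge' : g (Sum.inr e) = Sum.inl none := by simp [g, hFe]
  have hg₀ : g (Sum.inl none) = Sum.inl none := hg none
  have hgj₁ : ∀ b, g (Sum.inl (some (j b))) = Sum.inl (some b) := fun b => hg (some b)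
  have hgi₁ : ∀ a, g (Sum.inl (some (i a))) = Sum.inl none := fun a => hgi (some a)
  have hroot : ∀ b, R.black (some b) = none →
      R.Linked Set.univ (Sum.inl (some b)) (Sum.inl none) := fun b hb => by
    rw [← hb]; exact linked_black R _ _
  have hroot' : ∀ b, R.black (some b) = none →
      R.Linked Set.univ (Sum.inr b) (Sum.inl none) := fun b hb =>
    (linked_edge R (Set.mem_univ b)).symm.trans (hroot b hb)
  rw [connected_iff_root]
  intro a
  have key := (hM (Sum.inl none) (Sum.inl (some (j a)))).map (N := R) (T := Set.univ) g
    ?_ (fun x => ?_) fun x hx => ?_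
  · rwa [hg₀, hgj₁] at key
  · rintro (_ | x)
    · rw [hg₀, h.black_none, hge]; exact .rfl
    · rcases h.cover x with rfl | ⟨a, rfl⟩ | ⟨b, rfl⟩
      · rw [h.black_new, hgi, hge]; exact .rfl
      · rw [h.black_left, hgi, hgi₁]; exact .rfl
      · by_cases hb : R.black (some b) = none
        · rw [h.black_right' b hb, hg, hgj₁]
          exact (hroot b hb).trans (linked_black R _ _)
        · rw [h.black_right b hb, hg, hgj₁]; exact linked_black R _ _
  · rcases h.cover x with rfl | ⟨a, rfl⟩ | ⟨b, rfl⟩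
    · rcases R.black_none_cases with ⟨h₁, -⟩ | ⟨-, b, hb⟩
      · rw [h.white_leaf h₁]; exact .rfl
      · rw [h.white_new b hb, hge', hgj']; exact (hroot' b hb).symm
    · rw [h.white_left, hgi', hgi']; exact .rfl
    · by_cases hb : R.black (some (R.white b)) = none
      · rw [h.white_right' b hb, hgj', hge']
        exact (linked_white R _ b).trans (hroot' _ hb)
      · rw [h.white_right b hb, hgj', hgj']; exact linked_white R _ _
  · rcases h.cover x with rfl | ⟨a, rfl⟩ | ⟨b, rfl⟩
    · rw [hge, hge']; exact .rfl
    · rw [hgi₁, hgi']; exact .rfl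
    · rw [hgj₁, hgj']; exact linked_edge R (Set.mem_univ b)

end IsJoin

/-- Without the bridge the half-edges fall into two classes, `P` around its black end and `Q` around
its white end; the other edges of each class form `L` and `R`. -/
theorem exists_isJoin {E : Type} [Finite E] {M : RotationSystem E} (hM : M.Connected) {e : E}
    (h0 : M.black none = some e) (he : M.IsBridge e) :
    ∃ (A B : Type) (L : RotationSystem A) (R : RotationSystem B) (i : A → E) (j : B → E),
      Finite A ∧ Finite B ∧ L.Connected ∧ R.Connected ∧ IsJoin L R M i j e := by
  let P := M.Linked {g | g ≠ e} (Sum.inl (some e))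
  let Q := M.Linked {g | g ≠ e} (Sum.inr e)
  have hPQ : ∀ {z}, P z → Q z → False := fun hp hq => he (hp.trans hq.symm)
  have hcover : ∀ z, P z ∨ Q z := fun z => by
    refine ((hM (Sum.inl (some e)) z).iff (p := fun z => P z ∨ Q z) (fun x => ?_) (fun x => ?_)
      fun x _ => ?_).1 (Or.inl .rfl)
    · have := linked_black M {g | g ≠ e} x
      exact or_congr ⟨fun h => h.trans this, fun h => h.trans this.symm⟩
        ⟨fun h => h.trans this, fun h => h.trans this.symm⟩
    · have := linked_white M {g | g ≠ e} x
      exact or_congr ⟨fun h => h.trans this, fun h => h.trans this.symm⟩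
        ⟨fun h => h.trans this, fun h => h.trans this.symm⟩
    · by_cases hx : x = e
      · subst hx; exact iff_of_true (Or.inl .rfl) (Or.inr .rfl)
      · have := linked_edge M (S := {g | g ≠ e}) hx
        exact or_congr ⟨fun h => h.trans this, fun h => h.trans this.symm⟩
          ⟨fun h => h.trans this, fun h => h.trans this.symm⟩
  have hPnone : P (Sum.inl none) := by
    have := linked_black M {g | g ≠ e} none
    rw [h0] at this
    exact this.symm
  have hblack : ∀ x, x ≠ none → M.black x ≠ some e := fun x hx => by
    rw [← h0]; exact M.black.injective.ne hx
  let i : {x // x ≠ e ∧ P (Sum.inl (some x))} → E := Subtype.val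
  let j : {x // x ≠ e ∧ Q (Sum.inl (some x))} → E := Subtype.val
  have hi : Function.Injective i := Subtype.val_injective
  have hj : Function.Injective j := Subtype.val_injective
  have hPw : ∀ a, P (Sum.inr (i a)) := fun a => Linked.trans a.2.2 (linked_edge M a.2.1)
  have hQw : ∀ b, Q (Sum.inr (j b)) := fun b => Linked.trans b.2.2 (linked_edge M b.2.1)
  have hi₁ : ∀ x, x ≠ e → P (Sum.inr x) → ∃ a, x = i a := fun x hx hP =>
    ⟨⟨x, hx, hP.trans (linked_edge M hx).symm⟩, rfl⟩
  have hj₁ : ∀ x, x ≠ e → Q (Sum.inr x) → ∃ b, x = j b := fun x hx hQ =>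
    ⟨⟨x, hx, hQ.trans (linked_edge M hx).symm⟩, rfl⟩
  have hi₂ : ∀ x : Option E, x ≠ some e → P (Sum.inl x) →
      ∃ a : Option {x // x ≠ e ∧ P (Sum.inl (some x))}, x = a.map i := by
    rintro (_ | x) hx hP
    · exact ⟨none, rfl⟩
    · exact ⟨some ⟨x, by simpa using hx, hP⟩, rfl⟩
  have hdisj : ∀ a b, i a ≠ j b := fun a b hab => hPQ (hPw a) (hab ▸ hQw b)
  have hne : ∀ a, i a ≠ e := fun a => a.2.1
  have hne' : ∀ b, j b ≠ e := fun b => b.2.1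
  have hwe : M.white e ≠ e → ∃ b, M.white e = j b := fun h =>
    hj₁ _ h (linked_white M _ e)
  have hiw : ∀ a, i a ≠ M.white e := fun a ha => by
    obtain ⟨b, hb⟩ := hwe fun h => hne a (ha.trans h)
    exact hdisj a b (ha.trans hb)
  -- The first transposition takes `e` out of its black cycle. The second puts it just after
  -- `M.white e`, where it plays the root leg of `R`; if `M.white e = e`, it is trivial and this leg
  -- stays alone.
  set β₁ := insertAfter M.black (some e) none with hβ₁
  set β := insertAfter β₁ (some e) (some (M.white e)) with hβ
  have hβ₁e : β₁ (some e) = some e := by rw [hβ₁, insertAfter_left, h0]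
  have hβ₁none : β₁ none = M.black (some e) := insertAfter_right _ _ _
  have hβ₁x : ∀ x, x ≠ e → β₁ (some x) = M.black (some x) := fun x hx =>
    insertAfter_of_ne _ (by simpa using hx) (by simp)
  have hβnone : β none = M.black (some e) := by
    rw [hβ, insertAfter_of_ne _ (by simp) (by simp), hβ₁none]
  have hβi : ∀ a, β (some (i a)) = M.black (some (i a)) := fun a => by
    rw [hβ, insertAfter_of_ne _ (by simpa using hne a) (by simpa using hiw a), hβ₁x _ (hne a)]
  have hβe : β (some e) = β₁ (some (M.white e)) := insertAfter_left _ _ _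
  have hβw : β (some (M.white e)) = some e := by
    rw [hβ, insertAfter_right, hβ₁e]
  have hβj : ∀ b, j b ≠ M.white e → β (some (j b)) = M.black (some (j b)) := fun b hb => by
    rw [hβ, insertAfter_of_ne _ (by simpa using hne' b) (by simpa using hb), hβ₁x _ (hne' b)]
  have hj₂ : ∀ b, ∃ c, M.black (some (j b)) = some (j c) := fun b => by
    have hQ : Q (Sum.inl (M.black (some (j b)))) := Linked.trans b.2.2 (linked_black M _ _)
    cases hc : M.black (some (j b)) with
    | none => rw [hc] at hQ; exact (hPQ hPnone hQ).elim
    | some x =>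
      have hx : x ≠ e := by rintro rfl; exact hblack _ (by simp) hc
      rw [hc] at hQ
      exact ⟨⟨x, hx, hQ⟩, rfl⟩
  obtain ⟨L₁, hL₁⟩ := exists_perm_of_semiconj (Option.map_injective hi) (π := β) fun x => by
    rcases x with _ | a
    · rw [Option.map_none, hβnone]
      exact hi₂ _ (hblack _ (by simp)) (linked_black M _ _)
    · rw [Option.map_some, hβi]
      exact hi₂ _ (hblack _ (by simp)) (Linked.trans a.2.2 (linked_black M _ _))
  have hinj : Function.Injective
      fun x : Option {x // x ≠ e ∧ Q (Sum.inl (some x))} => some (x.elim e j) := by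
    rintro (_ | b) (_ | b') hab
    · rfl
    · exact absurd (by simpa using hab.symm) (hne' b')
    · exact absurd (by simpa using hab) (hne' b)
    · exact congrArg some (hj (by simpa using hab))
  obtain ⟨R₁, hR₁⟩ := exists_perm_of_semiconj hinj (π := β) fun x => by
    rcases x with _ | b
    · rw [Option.elim_none, hβe]
      by_cases hw : M.white e = e
      · exact ⟨none, by rw [hw, hβ₁e]; rfl⟩
      · obtain ⟨b, hb⟩ := hwe hw
        obtain ⟨c, hc⟩ := hj₂ b
        exact ⟨some c, by rw [hβ₁x _ hw, hb, hc]; rfl⟩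
    · rw [Option.elim_some]
      by_cases hb : j b = M.white e
      · exact ⟨none, by rw [hb, hβw]; rfl⟩
      · obtain ⟨c, hc⟩ := hj₂ b
        exact ⟨some c, by rw [hβj b hb, hc]; rfl⟩
  set ω := detach M.white e with hω
  have hωi : ∀ a, M.white (i a) ≠ e := fun a h =>
    hPQ ((hPw a).trans (linked_white M _ _)) (h ▸ .rfl)
  have hωi' : ∀ a, ω (i a) = M.white (i a) := fun a => detach_of_ne _ (hne a) (hωi a)
  obtain ⟨L₂, hL₂⟩ := exists_perm_of_semiconj hi (π := ω) fun a => by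
    rw [hωi']
    exact hi₁ _ (hωi a) ((hPw a).trans (linked_white M _ _))
  obtain ⟨R₂, hR₂⟩ := exists_perm_of_semiconj hj (π := ω) fun b => by
    by_cases hb : M.white (j b) = e
    · rw [hω, detach_of_apply_eq _ hb]
      exact hwe fun h => hne' b (M.white.injective (hb.trans h.symm))
    · rw [hω, detach_of_ne _ (hne' b) hb]
      exact hj₁ _ hb ((hQw b).trans (linked_white M _ _))
  have hlast : ∀ b, R₁ (some b) = none ↔ j b = M.white e := fun b => by
    have h₁ := hR₁ (some b)
    rw [Option.elim_some] at h₁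
    constructor
    · intro h
      by_contra hb
      rw [hβj b hb, h] at h₁
      exact hblack _ (by simp) h₁
    · intro h
      rw [h, hβw] at h₁
      exact hinj h₁.symm
  have key : IsJoin ⟨L₁, L₂⟩ ⟨R₁, R₂⟩ M i j e := by
    refine ⟨hi, hj, hdisj, hne, hne', fun x => ?_, h0, ?_, fun a => ?_, fun b hb => ?_,
      fun b hb => ?_, fun a => ?_, fun h => ?_, fun b hb => ?_, fun b hb => ?_, fun b hb => ?_⟩
    · by_cases hx : x = e
      · exact Or.inl hx
      · exact Or.inr ((hcover (Sum.inr x)).imp (hi₁ x hx) (hj₁ x hx))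
    · rw [← hL₁, Option.map_none, hβnone]
    · rw [← hL₁, Option.map_some, hβi]
    · have h₁ := hR₁ (some b)
      obtain ⟨c, hc⟩ := Option.ne_none_iff_exists'.1 hb
      have hc : R₁ (some b) = some c := hc
      rw [Option.elim_some, hβj b (mt (hlast b).2 hb), hc] at h₁
      rw [h₁, hc]; rfl
    · have h₁ := hR₁ none
      have hw := (hlast b).1 hb
      have hne₀ : R₁ none ≠ none := fun h => by simpa using R₁.injective (h.trans hb.symm)
      obtain ⟨c, hc⟩ := Option.ne_none_iff_exists'.1 hne₀
      rw [Option.elim_none, hβe, ← hw, hβ₁x _ (hne' b), hc] at h₁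
      rw [h₁, hc]; rfl
    · rw [← hωi', hL₂]
    · by_contra hw
      obtain ⟨b, hb⟩ := hwe hw
      have := R₁.injective (((hlast b).2 hb.symm).trans h.symm)
      simp at this
    · exact ((hlast b).1 hb).symm
    · have h₁ := hR₂ b
      by_cases hw : M.white (j b) = e
      · rw [hω, detach_of_apply_eq _ hw] at h₁
        exact absurd ((hlast _).2 h₁.symm) hb
      · rwa [hω, detach_of_ne _ (hne' b) hw] at h₁
    · have h₁ := hR₂ b
      rw [(hlast _).1 hb] at h₁
      by_contra hw
      rw [hω, detach_of_ne _ (hne' b) hw] at h₁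
      exact hne' b (M.white.injective h₁)
  exact ⟨_, _, _, _, i, j, inferInstance, inferInstance, key.connected_left hM,
    key.connected_right hM, key⟩

/-- The Euler characteristic of a connected map is at most two. -/
theorem euler_le {E : Type} [Finite E] {M : RotationSystem E} (hM : M.Connected) :
    M.numBlack + M.numWhite + M.numFaces ≤ Nat.card E + 2 := by
  induction hn : Nat.card E using Nat.strong_induction_on generalizing E with
  | _ n ih =>
    subst hn
    cases h0 : M.black none with
    | none =>
      have := isEmpty_of_connected hM h0
      rw [numBlack, numWhite, numFaces, numCycles_of_subsingleton, numCycles_of_isEmpty,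
        numCycles_of_subsingleton]
      omega
    | some e =>
      by_cases he : M.IsBridge e
      · obtain ⟨A, B, L, R, i, j, hA, hB, hL, hR, h⟩ := exists_isJoin hM h0 he
        have h₁ := h.card
        have h₂ := ih _ (by omega) hL rfl
        have h₃ := ih _ (by omega) hR rfl
        have h₄ := h.numFaces
        have h₅ := h.numBlack
        have h₆ := h.numWhite
        omega
      · obtain ⟨A, N, i, f, hA, hN, h⟩ := exists_isAddEdge hM h0 he
        have h₁ := h.card
        have h₂ := ih _ (by omega) hN rfl
        have h₅ := h.numBlack
        have h₆ := h.numWhite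
        by_cases hf : N.faces.SameCycle none (some f)
        · have h₄ := h.numFaces_of_sameCycle hf
          omega
        -- The edge connects two different faces and merges them, so the Euler characteristic drops
        -- by two.
        · have h₄ := h.numFaces_of_not_sameCycle hf
          omega

end RotationSystem

/-! ### The two operations that generate degree trees -/

namespace PlaneTree

/-- Add a new rightmost child by an edge labelled `0`. -/
def attach (t c : PlaneTree ℤ) : PlaneTree ℤ := node (t.label + c.label + 1) (t.children ++ [c])

/-- The tree whose root has the only child `c`, by an edge labelled `m`. -/
def graft (c : PlaneTree ℤ) (m : ℕ) : PlaneTree ℤ := node (1 - m + c.label) [c]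

theorem nodeLabels_addRight (t c : PlaneTree ℕ) :
    (t.addRight c).nodeLabels = t.nodeLabels.attach c.nodeLabels := by
  obtain ⟨a, cs⟩ := t
  simp only [addRight, nodeLabels, attach, label, children, List.map_append, List.map_cons,
    List.map_nil, List.sum_append, List.length_append, List.length_cons, List.length_nil,
    List.sum_cons, List.sum_nil]
  congr 1
  push_cast
  ring

theorem nodeLabels_node_singleton (m : ℕ) (c : PlaneTree ℕ) :
    (node m [c]).nodeLabels = c.nodeLabels.graft m := by
  simp [nodeLabels, graft]

theorem nodeLabels_leaf : (node 0 [] : PlaneTree ℕ).nodeLabels = node 0 [] := by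
  simp [nodeLabels]

theorem edgeLabel_attach (t c : PlaneTree ℤ) : (t.attach c).edgeLabel = t.edgeLabel := by
  obtain ⟨a, cs⟩ := t
  simp only [attach, edgeLabel, children, label, List.map_append, List.map_cons,
    List.map_nil, List.sum_append, List.length_append, List.length_cons, List.length_nil,
    List.sum_cons, List.sum_nil]
  push_cast
  ring

theorem edgeLabel_graft (c : PlaneTree ℤ) (m : ℕ) : (c.graft m).edgeLabel = m := by
  simp only [graft, edgeLabel, List.map_cons, List.map_nil, List.length_cons, List.length_nil,
    List.sum_cons, List.sum_nil]
  push_cast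
  ring

theorem size_attach (t c : PlaneTree ℤ) : (t.attach c).size = t.size + c.size + 1 := by
  obtain ⟨a, cs⟩ := t
  simp [attach, size, children]
  omega

theorem size_graft (c : PlaneTree ℤ) (m : ℕ) : (c.graft m).size = c.size + 1 := by
  simp [graft, size, add_comm]

section Counts

open Classical in
/-- The number of nodes that satisfy a condition on the subtree they induce. -/
noncomputable def count (p : PlaneTree ℤ → Prop) (t : PlaneTree ℤ) : ℕ :=
  t.subtrees.countP fun v => p v

open Classical in
theorem count_node (p : PlaneTree ℤ → Prop) (a : ℤ) (cs : List (PlaneTree ℤ)) :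
    count p (node a cs) = (if p (node a cs) then 1 else 0) + (cs.map (count p)).sum := by
  simp only [count, subtrees, List.countP_cons, List.countP_flatten, List.map_map,
    decide_eq_true_eq]
  rw [add_comm]
  rfl

-- Only the root changes: the subtree it induces is `t.attach c` instead of `t`, while all other
-- nodes keep theirs.
open Classical in
theorem count_attach (p : PlaneTree ℤ → Prop) (t c : PlaneTree ℤ) :
    count p (t.attach c) + (if p t then 1 else 0) =
      count p t + count p c + if p (t.attach c) then 1 else 0 := by
  obtain ⟨a, cs⟩ := t
  have h : attach (node a cs) c = node (a + c.label + 1) (cs ++ [c]) := rfl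
  rw [h, count_node, count_node p a cs]
  simp only [List.map_append, List.map_cons, List.map_nil, List.sum_append, List.sum_cons,
    List.sum_nil]
  omega

open Classical in
theorem count_graft (p : PlaneTree ℤ → Prop) (c : PlaneTree ℤ) (m : ℕ) :
    count p (c.graft m) = count p c + if p (c.graft m) then 1 else 0 := by
  have h : c.graft m = node (1 - m + c.label) [c] := rfl
  rw [h, count_node]
  simp [add_comm]

theorem lnode_eq (t : PlaneTree ℤ) : t.lnode = count (fun v => v.children = []) t := by
  unfold lnode count; congr!

theorem znode_eq (t : PlaneTree ℤ) :
    t.znode = count (fun v => v.children ≠ [] ∧ v.edgeLabel = 0) t := by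
  unfold znode count; congr!

theorem pnode_eq (t : PlaneTree ℤ) :
    t.pnode = count (fun v => v.children ≠ [] ∧ v.edgeLabel ≠ 0) t := by
  unfold pnode count; congr!

theorem children_attach_ne (t c : PlaneTree ℤ) : (t.attach c).children ≠ [] := by
  simp [attach, children]

theorem children_graft_ne (c : PlaneTree ℤ) (m : ℕ) : (c.graft m).children ≠ [] := by
  simp [graft, children]

end Counts

namespace IsDegreeTree

/-- The subtracted `a` is absorbed by the label of the first child. -/
theorem label_nonneg {t : PlaneTree ℤ} (h : t.IsDegreeTree) : 0 ≤ t.label := by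
  induction h with
  | leaf => exact le_rfl
  | internal v₁ vs a hv ha₀ ha₁ ih =>
    have : 0 ≤ (vs.map label).sum := by
      refine List.sum_nonneg fun x hx => ?_
      obtain ⟨v, hv', rfl⟩ := List.mem_map.1 hx
      exact ih v (List.mem_cons_of_mem _ hv')
    simp only [label, List.length_cons, List.map_cons, List.sum_cons]
    push_cast
    change 0 ≤ (vs.length + 1 : ℤ) - a + (v₁.label + (vs.map label).sum)
    omega

theorem eq_leaf {t : PlaneTree ℤ} (h : t.IsDegreeTree) (hc : t.children = []) :
    t = node 0 [] := by
  cases h with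
  | leaf => rfl
  | internal v₁ vs a hv ha₀ ha₁ => simp [children] at hc

theorem attach {t c : PlaneTree ℤ} (ht : t.IsDegreeTree) (hc : c.IsDegreeTree) :
    (t.attach c).IsDegreeTree := by
  cases ht with
  | leaf =>
    have := internal c [] 0 (by simpa using hc) le_rfl hc.label_nonneg
    convert this using 1
    simp only [PlaneTree.attach, label, children, List.length_cons, List.length_nil,
      List.map_cons, List.map_nil, List.sum_cons, List.sum_nil, List.nil_append]
    congr 1
    push_cast
    ring
  | internal v₁ vs a hv ha₀ ha₁ =>
    have := internal v₁ (vs ++ [c]) a (fun v hv' => by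
      rw [← List.cons_append, List.mem_append, List.mem_singleton] at hv'
      rcases hv' with hv' | rfl
      · exact hv v hv'
      · exact hc) ha₀ ha₁
    convert this using 1
    simp only [PlaneTree.attach, label, children, List.length_cons, List.length_append,
      List.length_nil, List.map_append, List.map_cons, List.map_nil, List.sum_append,
      List.sum_cons, List.sum_nil, List.cons_append]
    congr 1
    push_cast
    ring

theorem graft {c : PlaneTree ℤ} {m : ℕ} (hc : c.IsDegreeTree) (hm : (m : ℤ) ≤ c.label) :
    (c.graft m).IsDegreeTree := by
  have := internal c [] m (by simpa using hc) (Int.natCast_nonneg m) hm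
  simpa [PlaneTree.graft] using this

/-- Degree trees are built from a leaf by adding rightmost children and by adding a new root. -/
theorem attach_induction {P : PlaneTree ℤ → Prop} (hleaf : P (node 0 []))
    (hattach : ∀ t c : PlaneTree ℤ, t.IsDegreeTree → c.IsDegreeTree → P t → P c → P (t.attach c))
    (hgraft : ∀ (c : PlaneTree ℤ) (m : ℕ), c.IsDegreeTree → 1 ≤ m → (m : ℤ) ≤ c.label → P c →
      P (c.graft m)) {t : PlaneTree ℤ} (ht : t.IsDegreeTree) : P t := by
  induction ht with
  | leaf => exact hleaf
  | internal v₁ vs a hv ha₀ ha₁ ih =>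
    -- The later children are varied with `v₁` and `a` fixed, so that they can be removed from the
    -- right. Being a degree tree is carried along because the attaching step requires it of the
    -- shortened tree.
    suffices h : ∀ us : List (PlaneTree ℤ), (∀ u ∈ us, u ∈ v₁ :: vs) →
        (node (((v₁ :: us).length : ℤ) - a + ((v₁ :: us).map label).sum) (v₁ :: us)).IsDegreeTree ∧
        P (node (((v₁ :: us).length : ℤ) - a + ((v₁ :: us).map label).sum) (v₁ :: us)) from
      (h vs fun u hu => List.mem_cons_of_mem _ hu).2
    intro us
    induction us using List.reverseRecOn with
    | nil =>
      intro _
      have hv₁ := hv v₁ List.mem_cons_self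
      refine ⟨internal v₁ [] a (by simpa using hv₁) ha₀ ha₁, ?_⟩
      obtain ⟨m, rfl⟩ := Int.eq_ofNat_of_zero_le ha₀
      rcases Nat.eq_zero_or_pos m with rfl | hm
      · have := hattach _ v₁ leaf hv₁ hleaf (ih v₁ List.mem_cons_self)
        convert this using 1
        simp only [PlaneTree.attach, label, children, List.length_cons, List.length_nil,
          List.map_cons, List.map_nil, List.sum_cons, List.sum_nil, List.nil_append]
        congr 1
        push_cast
        ring
      · have := hgraft v₁ m hv₁ hm ha₁ (ih v₁ List.mem_cons_self)
        simpa [PlaneTree.graft] using this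
    | append_singleton us u ihu =>
      intro hus
      obtain ⟨h₁, h₂⟩ := ihu fun w hw => hus w (by simp [hw])
      have hu : u ∈ v₁ :: vs := hus u (by simp)
      have heq : node (((v₁ :: (us ++ [u])).length : ℤ) - a +
          ((v₁ :: (us ++ [u])).map label).sum) (v₁ :: (us ++ [u])) =
          (node (((v₁ :: us).length : ℤ) - a + ((v₁ :: us).map label).sum)
            (v₁ :: us)).attach u := by
        simp only [PlaneTree.attach, label, children, List.length_cons, List.length_append,
          List.length_nil, List.map_append, List.map_cons, List.map_nil, List.sum_append,
          List.sum_cons, List.sum_nil, List.cons_append]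
        congr 1
        push_cast
        ring
      rw [heq]
      exact ⟨h₁.attach (hv u hu), hattach _ u h₁ (hv u hu) h₂ (ih u hu)⟩

end IsDegreeTree

end PlaneTree

/-! ### The map of a tree under the two operations -/

namespace BipartiteMap

open PlaneTree

theorem ofTree_leaf (l : ℤ) : ofTree (.node l []) = vertexMap := by
  rw [ofTree]

/-- For a one-node `t` the hypothesis forces the label `0`; another label would turn the new edge
into one with a nonzero label, and a face could be closed instead. -/
theorem ofTree_attach {t c : PlaneTree ℤ} (ht : t.IsDegreeTree) :
    ofTree (t.attach c) = addChild (ofTree t) (ofTree c) := by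
  have he := edgeLabel_attach t c
  cases ht with
  | leaf =>
    have h : PlaneTree.attach (node 0 []) c = node (0 + c.label + 1) [c] := rfl
    rw [h] at he ⊢
    rw [ofTree_leaf, ofTree, if_pos (by rw [he]; simp [edgeLabel])]
    rfl
  | internal v₁ vs a hv ha₀ ha₁ =>
    generalize ((v₁ :: vs).length : ℤ) - a + ((v₁ :: vs).map label).sum = l at he ⊢
    have h : PlaneTree.attach (node l (v₁ :: vs)) c =
      node (l + c.label + 1) (v₁ :: (vs ++ [c])) := rfl
    rw [h] at he ⊢
    rw [ofTree, ofTree, he, List.map_append, List.foldl_append]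
    rfl

theorem ofTree_graft (c : PlaneTree ℤ) {m : ℕ} (hm : 1 ≤ m) :
    ofTree (c.graft m) = closeFace (ofTree c) m := by
  have he := edgeLabel_graft c m
  have h : c.graft m = node (1 - m + c.label) [c] := rfl
  rw [h] at he ⊢
  rw [ofTree, he, if_neg (by omega)]
  rfl

end BipartiteMap

/-! ### The correspondence between maps and degree trees -/

namespace RotationSystem

open PlaneTree

open Classical in
/-- The map `M` corresponds to the degree tree `t`. -/
structure Represents {E : Type} (M : RotationSystem E) (t : PlaneTree ℤ) : Prop where
  connected : M.Connected
  euler : M.numBlack + M.numWhite + M.numFaces = Nat.card E + 2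
  card : Nat.card E = t.size
  leaf : M.black none = none ↔ t.children = []
  white : M.numWhite + (if t.children = [] then 1 else 0) = t.lnode
  black : M.numBlack = t.znode + if t.children = [] then 1 else 0
  faces : M.numFaces = 1 + t.pnode
  outdeg : (M.outdeg : ℤ) = t.label
  explore : ∀ k, t.size ≤ k → (explore k M).nodeLabels = t

/-- This case is the reason for the correction terms in `Represents`: the map has a black vertex and
no white one, whereas its tree has a leaf and no zero node. -/
theorem represents_vertexMap : Represents BipartiteMap.vertexMap.rot (node 0 []) := by
  have : IsEmpty BipartiteMap.vertexMap.Edge := inferInstanceAs (IsEmpty Empty)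
  have h0 : BipartiteMap.vertexMap.rot.black none = none := rfl
  have hb : BipartiteMap.vertexMap.rot.numBlack = 1 := numCycles_of_subsingleton _
  have hw : BipartiteMap.vertexMap.rot.numWhite = 0 := numCycles_of_isEmpty _
  have hf : BipartiteMap.vertexMap.rot.numFaces = 1 := numCycles_of_subsingleton _
  refine ⟨connected_iff_root.2 fun e => this.elim e, ?_, ?_, ?_, ?_, ?_, ?_, ?_, fun k _ => ?_⟩
  · rw [hb, hw, hf, Nat.card_of_isEmpty]
  · simp [size]
  · simp [h0, children]
  · rw [hw, lnode_eq, count_node]; simp [children]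
  · rw [hb, znode_eq, count_node]; simp [children]
  · rw [hf, pnode_eq, count_node]; simp [children]
  · rw [outdeg_of_black_none h0]; rfl
  · rw [explore_of_black_none k h0, nodeLabels_leaf]

/-- If `c` is a leaf, the bridge brings a new white vertex; otherwise it ends at a white vertex of
`R`. If `t` is a leaf, its root turns into a zero node, which accounts for the black vertex of `L`.
-/
theorem IsJoin.represents {A B E : Type} [Finite A] [Finite B] {L : RotationSystem A}
    {R : RotationSystem B} {M : RotationSystem E} {i : A → E} {j : B → E} {e : E}
    (h : IsJoin L R M i j e) {t c : PlaneTree ℤ} (hL : L.Represents t) (hR : R.Represents c)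
    (ht : t.IsDegreeTree) : M.Represents (t.attach c) := by
  have hw := h.numWhite
  have hb := h.numBlack
  have hf := h.numFaces
  have hcard := h.card
  have hEL := hL.euler
  have hER := hR.euler
  have hwL := hL.white
  have hwR := hR.white
  have hbL := hL.black
  have hbR := hR.black
  have hfL := hL.faces
  have hfR := hR.faces
  have hne := children_attach_ne t c
  have he : t.children = [] → t.edgeLabel = 0 := fun htc => by
    rw [ht.eq_leaf htc]; simp [edgeLabel]
  have hl := count_attach (fun v => v.children = []) t c
  have hz := count_attach (fun v => v.children ≠ [] ∧ v.edgeLabel = 0) t c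
  have hp := count_attach (fun v => v.children ≠ [] ∧ v.edgeLabel ≠ 0) t c
  simp only [← lnode_eq, ← znode_eq, ← pnode_eq, edgeLabel_attach, hne, if_false, ne_eq,
    not_false_eq_true, true_and] at hl hz hp
  simp only [hR.leaf] at hw hb
  refine ⟨h.connected hL.connected hR.connected, by omega, ?_, ?_, ?_, ?_, ?_, ?_, fun k hk => ?_⟩
  · rw [hcard, hL.card, hR.card, size_attach]
  · simp [h.black_none, hne]
  · rw [if_neg hne]
    by_cases htc : t.children = [] <;> by_cases hcc : c.children = [] <;>
      simp only [htc, hcc, if_true, if_false] at hl hwL hw hwR <;> omega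
  · rw [if_neg hne]
    by_cases htc : t.children = []
    · simp only [htc, he htc, if_true, not_true_eq_false, false_and, if_false] at hz hbL
      by_cases hcc : c.children = [] <;> simp only [hcc, if_true, if_false] at hb hbR <;> omega
    · simp only [htc, if_false, not_false_eq_true, true_and] at hz hbL
      by_cases hcc : c.children = [] <;> simp only [hcc, if_true, if_false] at hb hbR <;> omega
  · by_cases htc : t.children = []
    · simp only [htc, he htc, not_true_eq_false, false_and, if_false] at hp
      omega
    · simp only [htc, not_false_eq_true, true_and] at hp
      omega
  · have := hL.outdeg
    have := hR.outdeg
    rw [h.outdeg]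
    change _ = t.label + c.label + 1
    push_cast
    omega
  · rw [size_attach] at hk
    obtain ⟨k, rfl⟩ : ∃ k', k = k' + 1 := ⟨k - 1, by omega⟩
    have h₁ : BipTree.explore k (M.delete e) = BipTree.explore k L :=
      explore_of_isEmbedding k h.isEmbedding_left
    simp only [BipTree.explore, h.black_none, if_pos h.isBridge, h.white_new_eq_iff, h₁]
    split_ifs with h₂
    -- With a lone root leg, exploring `R` would also yield just a leaf, and this identifies the
    -- leaf produced here with `c`.
    · rw [nodeLabels_addRight, hL.explore k (by omega), nodeLabels_leaf, ← hR.explore k (by omega),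
        explore_of_black_none k h₂, nodeLabels_leaf]
    · rw [nodeLabels_addRight, hL.explore k (by omega),
        explore_of_isEmbedding k (h.isEmbedding_right h₂), hR.explore k (by omega)]

/-- The new edge adds one face and no vertex, as the new root adds one positive node and neither a
leaf nor a zero node. -/
theorem IsAddEdge.represents {A E : Type} [Finite A] {N : RotationSystem A}
    {M : RotationSystem E} {i : A → E} {e : E} {f : A} (h : IsAddEdge N M i e f)
    {c : PlaneTree ℤ} (hN : N.Represents c) {m : ℕ} (hm : 1 ≤ m) (hm' : (m : ℤ) ≤ c.label)
    (hf : (N.faces ^ m) none = some f) : M.Represents (c.graft m) := by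
  have hle : m ≤ N.outdeg := by
    have := hN.outdeg
    omega
  have hsame : N.faces.SameCycle none (some f) := by
    rw [← hf]; exact Equiv.Perm.sameCycle_pow_right.2 .rfl
  have hw := h.numWhite
  have hb := h.numBlack
  have hF := h.numFaces_of_sameCycle hsame
  have hcard := h.card
  obtain ⟨hdeg, hout⟩ := h.degrees hm hle hf
  -- A lone root leg has outer half-degree `0`, which leaves no room for `1 ≤ m`.
  have hc : c.children ≠ [] := fun hc => by
    have := outdeg_of_black_none (hN.leaf.2 hc)
    omega
  have hne := children_graft_ne c m
  have hm₀ : (m : ℤ) ≠ 0 := by omega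
  have hE := hN.euler
  have hwN := hN.white
  have hbN := hN.black
  have hfN := hN.faces
  rw [if_neg hc] at hwN hbN
  have hl := count_graft (fun v => v.children = []) c m
  have hz := count_graft (fun v => v.children ≠ [] ∧ v.edgeLabel = 0) c m
  have hp := count_graft (fun v => v.children ≠ [] ∧ v.edgeLabel ≠ 0) c m
  simp only [← lnode_eq, ← znode_eq, ← pnode_eq, edgeLabel_graft, hne, if_false, ne_eq,
    not_false_eq_true, true_and, hm₀, if_true] at hl hz hp
  refine ⟨h.connected hN.connected, by omega, ?_, ?_, ?_, ?_, ?_, ?_, fun k hk => ?_⟩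
  · rw [hcard, hN.card, size_graft]
  · simp [h.black_none, hne]
  · rw [if_neg hne]; omega
  · rw [if_neg hne]; omega
  · omega
  · have := hN.outdeg
    change _ = 1 - (m : ℤ) + c.label
    omega
  · rw [size_graft] at hk
    obtain ⟨k, rfl⟩ : ∃ k', k = k' + 1 := ⟨k - 1, by omega⟩
    simp only [BipTree.explore, h.black_none, if_neg (h.not_isBridge hN.connected), hdeg]
    rw [nodeLabels_node_singleton, explore_of_isEmbedding k h.isEmbedding_delete,
      hN.explore k (by omega)]

/-- The outer cycle has length `N.outdeg + 1`, so the walk does not return to the root leg within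
`m` steps. -/
theorem exists_pow_faces {A : Type} [Finite A] {N : RotationSystem A} {m : ℕ} (hm : 1 ≤ m)
    (hm' : m ≤ N.outdeg) : ∃ f, (N.faces ^ m) none = some f := by
  refine Option.ne_none_iff_exists'.1 fun h => ?_
  have := pow_injOn_minimalPeriod N.faces none (i := m) (j := 0)
    (by rw [minimalPeriod_faces_none]; omega) (by rw [minimalPeriod_faces_none]; omega) (by simpa)
  omega

theorem represents_ofTree {t : PlaneTree ℤ} (ht : t.IsDegreeTree) :
    (BipartiteMap.ofTree t).rot.Represents t := by
  refine IsDegreeTree.attach_induction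
    (P := fun t => (BipartiteMap.ofTree t).rot.Represents t) ?_ ?_ ?_ ht
  · rw [BipartiteMap.ofTree_leaf]; exact represents_vertexMap
  · intro t c ht hc iht ihc
    rw [BipartiteMap.ofTree_attach ht]
    exact (isJoin_join _ _).represents iht ihc ht
  · intro c m hc hm hm' ih
    rw [BipartiteMap.ofTree_graft c hm]
    have hout := ih.outdeg
    obtain ⟨f, hf⟩ := exists_pow_faces (N := (BipartiteMap.ofTree c).rot) hm (by omega)
    exact (isAddEdge_closeFace hf).represents ih hm hm' hf

/-- The defect in Euler's formula is additive under joining and nonnegative by `euler_le`; being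
zero for `M`, it is zero for both parts. -/
theorem IsPlanarMap.exists_isIso_ofTree {E : Type} [Finite E] {M : RotationSystem E}
    (hM : M.IsPlanarMap) : ∃ t : PlaneTree ℤ, t.IsDegreeTree ∧
      ∃ f : E ≃ (BipartiteMap.ofTree t).Edge, M.IsIso (BipartiteMap.ofTree t).rot f := by
  induction hn : Nat.card E using Nat.strong_induction_on generalizing E with
  | _ n ih =>
    subst hn
    obtain ⟨hconn, heuler⟩ := hM
    cases h0 : M.black none with
    | none =>
      have := isEmpty_of_connected hconn h0
      have : IsEmpty BipartiteMap.vertexMap.Edge := inferInstanceAs (IsEmpty Empty)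
      refine ⟨node 0 [], .leaf, ?_⟩
      rw [BipartiteMap.ofTree_leaf]
      exact ⟨Equiv.equivOfIsEmpty _ _, fun x => Subsingleton.elim _ _, fun x => isEmptyElim x⟩
    | some e =>
      by_cases he : M.IsBridge e
      · obtain ⟨A, B, L, R, i, j, hA, hB, hL, hR, h⟩ := exists_isJoin hconn h0 he
        have h₁ := h.card
        have h₂ := euler_le hL
        have h₃ := euler_le hR
        have h₄ := h.numFaces
        have h₅ := h.numBlack
        have h₆ := h.numWhite
        obtain ⟨t, ht, f, hf⟩ := ih _ (by omega) ⟨hL, by omega⟩ rfl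
        obtain ⟨c, hc, g, hg⟩ := ih _ (by omega) ⟨hR, by omega⟩ rfl
        refine ⟨t.attach c, ht.attach hc, ?_⟩
        rw [BipartiteMap.ofTree_attach ht]
        exact h.exists_isIso ((isJoin_join _ _).of_isIso hf hg)
      · obtain ⟨A, N, i, f, hA, hN, h⟩ := exists_isAddEdge hconn h0 he
        have h₁ := h.card
        have h₂ := euler_le hN
        have h₃ := h.numBlack
        have h₄ := h.numWhite
        by_cases hf : N.faces.SameCycle none (some f)
        · have h₅ := h.numFaces_of_sameCycle hf
          obtain ⟨c, hc, g, hg⟩ := ih _ (by omega) ⟨hN, by omega⟩ rfl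
          -- The label `m` is the position of `f` on the outer face of `N`, counted from the root
          -- leg; `m = 0` would be the leg itself.
          obtain ⟨m, hm, hmf⟩ := SameCycle.exists_lt_minimalPeriod hf
          rw [minimalPeriod_faces_none] at hm
          have hm₁ : 1 ≤ m := by
            rcases Nat.eq_zero_or_pos m with rfl | hm
            · simp at hmf
            · exact hm
          have hrep := represents_ofTree hc
          have hout := hrep.outdeg
          have hNout : (BipartiteMap.ofTree c).rot.outdeg = N.outdeg := hg.halfDegree none
          have hgf : ((BipartiteMap.ofTree c).rot.faces ^ m) none = some (g f) := by
            have := apply_of_semiconj hg.faces m none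
            rw [zpow_natCast, zpow_natCast, hmf] at this
            exact this
          refine ⟨c.graft m, hc.graft (by omega), ?_⟩
          rw [BipartiteMap.ofTree_graft c hm₁]
          have h' := (isAddEdge_closeFace hgf).of_isIso hg
          rw [Equiv.symm_apply_apply] at h'
          exact h.exists_isIso h'
        -- Here `N` would have Euler characteristic four, against `euler_le`.
        · have h₅ := h.numFaces_of_not_sameCycle hf
          omega

section Invariance

variable {E E' : Type} {M : RotationSystem E} {M' : RotationSystem E'} {f : E ≃ E'}

theorem IsIso.numBlack (h : M.IsIso M' f) : M'.numBlack = M.numBlack := numCycles_congr h.1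

theorem IsIso.numWhite (h : M.IsIso M' f) : M'.numWhite = M.numWhite := numCycles_congr h.2

theorem IsIso.numFaces (h : M.IsIso M' f) : M'.numFaces = M.numFaces := numCycles_congr h.faces

end Invariance

end RotationSystem

/-! ### The two transformations are mutually inverse -/

theorem treeOfMap_mapOfTree {t : PlaneTree ℤ} (ht : t.IsDegreeTree) :
    treeOfMap (mapOfTree t) = t := by
  have h := RotationSystem.represents_ofTree ht
  exact h.explore _ h.card.ge

theorem toRootedMap_mem_planarMaps {t : PlaneTree ℤ} (ht : t.IsDegreeTree) :
    mapOfTree t ∈ planarMaps t.size := by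
  have h := RotationSystem.represents_ofTree ht
  exact ⟨_, rfl, ⟨h.connected, h.euler⟩, h.card⟩

/-- Every planar map is the map of a degree tree. -/
theorem exists_mapOfTree_eq {M : BipartiteMap} (hM : M.rot.IsPlanarMap) :
    ∃ t ∈ degreeTrees (Nat.card M.Edge), mapOfTree t = M.toRootedMap ∧
      ∃ f : M.Edge ≃ (BipartiteMap.ofTree t).Edge,
        M.rot.IsIso (BipartiteMap.ofTree t).rot f := by
  obtain ⟨t, ht, f, hf⟩ := hM.exists_isIso_ofTree
  refine ⟨t, ⟨ht, ?_⟩, Quotient.sound ⟨f.symm, hf.symm⟩, f, hf⟩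
  rw [Nat.card_congr f, (RotationSystem.represents_ofTree ht).card]

end BipTree

theorem mainTheorem3 (n : ℕ) :
    Set.BijOn BipTree.treeOfMap (BipTree.planarMaps n) (BipTree.degreeTrees n) ∧
    Set.MapsTo BipTree.mapOfTree (BipTree.degreeTrees n) (BipTree.planarMaps n) ∧
    Set.InvOn BipTree.mapOfTree BipTree.treeOfMap
      (BipTree.planarMaps n) (BipTree.degreeTrees n) ∧
    ∀ M : BipTree.BipartiteMap, M.rot.IsPlanarMap → Nat.card M.Edge = n →
      (1 ≤ n →
        M.rot.numWhite = (BipTree.treeOfMap M.toRootedMap).lnode ∧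
        M.rot.numBlack = (BipTree.treeOfMap M.toRootedMap).znode) ∧
      M.rot.numFaces = 1 + (BipTree.treeOfMap M.toRootedMap).pnode ∧
      (M.rot.outdeg : ℤ) = (BipTree.treeOfMap M.toRootedMap).rlabel := by
  have hto : Set.MapsTo BipTree.mapOfTree (BipTree.degreeTrees n) (BipTree.planarMaps n) := by
    rintro t ⟨ht, rfl⟩
    exact BipTree.toRootedMap_mem_planarMaps ht
  have hfrom : Set.MapsTo BipTree.treeOfMap (BipTree.planarMaps n) (BipTree.degreeTrees n) := by
    rintro _ ⟨M, rfl, hM, rfl⟩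
    obtain ⟨t, ht, hMt, -⟩ := BipTree.exists_mapOfTree_eq hM
    rwa [← hMt, BipTree.treeOfMap_mapOfTree ht.1]
  have hinv : Set.InvOn BipTree.mapOfTree BipTree.treeOfMap
      (BipTree.planarMaps n) (BipTree.degreeTrees n) := by
    constructor
    -- Since every planar map is `mapOfTree t` for a degree tree `t`, this half follows from the
    -- other one.
    · rintro _ ⟨M, rfl, hM, rfl⟩
      obtain ⟨t, ht, hMt, -⟩ := BipTree.exists_mapOfTree_eq hM
      rw [← hMt, BipTree.treeOfMap_mapOfTree ht.1]
    · rintro t ⟨ht, -⟩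
      exact BipTree.treeOfMap_mapOfTree ht
  refine ⟨hinv.bijOn hfrom hto, hto, hinv, ?_⟩
  rintro M hM rfl
  obtain ⟨t, ⟨ht, hsize⟩, hMt, f, hf⟩ := BipTree.exists_mapOfTree_eq hM
  rw [← hMt, BipTree.treeOfMap_mapOfTree ht]
  have h := BipTree.RotationSystem.represents_ofTree ht
  refine ⟨fun hn => ?_, ?_, ?_⟩
  -- With at least one edge the tree is not a single leaf, and the correction terms vanish.
  · have hc : t.children ≠ [] := fun hc => by
      rw [ht.eq_leaf hc] at hsize
      simp [BipTree.PlaneTree.size] at hsize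
      omega
    rw [← hf.numWhite, ← hf.numBlack, ← h.white, h.black, if_neg hc]
    exact ⟨rfl, rfl⟩
  · rw [← hf.numFaces, h.faces]
  · have : (BipTree.BipartiteMap.ofTree t).rot.outdeg = M.rot.outdeg := hf.halfDegree none
    rw [← this, h.outdeg]
    rfl
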